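/- Let $\Omega\subset\mathbb R^3$ be a bounded, open, connected set with smooth boundary $\partial\Omega=\overline{\Gamma_0\cup\Gamma}$, where $\Gamma_0$ and $\Gamma$ are disjoint, connected, relatively open subsets of $\partial\Omega$ of positive surface measure, $\Gamma$ is flat (it is a domain in a plane), and the common relative boundary $\partial\Gamma=\partial\Gamma_0$ is a smooth curve. Let $1<p<5$. Let $$X=H^1_{\Gamma_0}(\Omega)\times H^2_0(\Gamma),\qquad \|(u,w)\|_X=\left(\|\nabla u\|_{L^2(\Omega)}^2+\|\Delta w\|_{L^2(\Gamma)}^2\right)^{1/2},$$ where $H^1_{\Gamma_0}(\Omega)$ is the space of real-valued $u\in H^1(\Omega)$ whose trace on $\Gamma_0$ vanishes, and $H^2_0(\Gamma)$ is the closure of $C_c^\infty(\Gamma)$ in $H^2(\Gamma)$. For $(u,w)\in X$ define, with $|s|^{p+1}\log|s|:=0$ at $s=0$, $$J(u,w)=\tfrac12\|(u,w)\|_X^2-\tfrac1{p+1}\left(\int_\Omega|u|^{p+1}\log|u|\,dx+\int_\Gamma|w|^{p+1}\log|w|\,d\Gamma\right)+\tfrac1{(p+1)^2}\left(\int_\Omega|u|^{p+1}dx+\int_\Gamma|w|^{p+1}d\Gamma\right),$$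 $$I(u,w)=\|(u,w)\|_X^2-\int_\Omega|u|^{p+1}\log|u|\,dx-\int_\Gamma|w|^{p+1}\log|w|\,d\Gamma .$$ Let $\mathcal N=\{(u,w)\in X\setminus\{(0,0)\}: I(u,w)=0\}$ be the Nehari manifold, $d=\inf_{\mathcal N}J$ the depth of the potential well, $W=\{(u,w)\in X: J(u,w)<d\}$ the potential well, and $$W_1=\{(u,w)\in W: I(u,w)>0\}\cup\{(0,0)\}$$ its stable part. Then $W_1$ is nontrivial, that is, it has an element other than $(0,0)$; more precisely, there exists $r>0$ such that the ball $B_r(0,0)=\{(u,w)\in X:\|(u,w)\|_X<r\}$ is contained in $W_1$. -/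

import Mathlib

open MeasureTheory Filter Topology
open scoped ContDiff ENNReal

noncomputable section

/-- Euclidean space `ℝⁿ`. -/
abbrev Euc (n : ℕ) : Type := EuclideanSpace ℝ (Fin n)

/-- The classical partial derivative `∂ᵢ φ`. -/
def partialDeriv {n : ℕ} (i : Fin n) (φ : Euc n → ℝ) : Euc n → ℝ :=
  fun x => fderiv ℝ φ x (EuclideanSpace.single i 1)

/-- Test functions on `U`: elements of `C_c^∞(U)`. -/
def IsTestFunction {n : ℕ} (U : Set (Euc n)) (φ : Euc n → ℝ) : Prop :=
  ContDiff ℝ ∞ φ ∧ HasCompactSupport φ ∧ tsupport φ ⊆ U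

/-- `g ∈ L²(U)` is the `i`-th weak partial derivative of `u ∈ L²(U)` in the open set `U`. -/
def IsWeakPartial {n : ℕ} (U : Set (Euc n)) (i : Fin n) (u g : Euc n → ℝ) : Prop :=
  MemLp u 2 (volume.restrict U) ∧ MemLp g 2 (volume.restrict U) ∧
    ∀ φ : Euc n → ℝ, IsTestFunction U φ →
      ∫ x in U, u x * partialDeriv i φ x = - ∫ x in U, g x * φ x

/-- `u ∈ H¹(U)`: `u` and its first order weak derivatives belong to `L²(U)`. -/
def MemH1 {n : ℕ} (U : Set (Euc n)) (u : Euc n → ℝ) : Prop :=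
  MemLp u 2 (volume.restrict U) ∧ ∀ i, ∃ g, IsWeakPartial U i u g

open Classical in
/-- The weak derivative `∂ᵢ u` in `L²(U)` (unique up to a null set of `U`; it is only used for `u`
that have one). -/
def weakPartial {n : ℕ} (U : Set (Euc n)) (i : Fin n) (u : Euc n → ℝ) : Euc n → ℝ :=
  if h : ∃ g, IsWeakPartial U i u g then h.choose else 0

/-- `w ∈ H²(U)`. -/
def MemH2 {n : ℕ} (U : Set (Euc n)) (w : Euc n → ℝ) : Prop :=
  MemH1 U w ∧ ∀ i, MemH1 U (weakPartial U i w)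

/-- The weak Laplacian `Δ w = ∑ᵢ ∂ᵢ ∂ᵢ w` of `w ∈ H²(U)`. -/
def weakLaplacian {n : ℕ} (U : Set (Euc n)) (w : Euc n → ℝ) : Euc n → ℝ :=
  fun x => ∑ i, weakPartial U i (weakPartial U i w) x

/-- `L²`-convergence `f k → f` with respect to `μ`. -/
def TendstoL2 {α : Type*} [MeasurableSpace α] (μ : Measure α) (f : ℕ → α → ℝ) (g : α → ℝ) :
    Prop :=
  Tendsto (fun k => eLpNorm (fun x => f k x - g x) 2 μ) atTop (𝓝 0)

/-- `u ∈ H¹(U)` has boundary trace `g` on `S ⊆ ∂U`: the trace operator is the continuous extension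
of the restriction map, so that there are functions `φ k`, smooth up to the boundary, with
`φ k → u` in `H¹(U)` and `φ k → g` in `L²(S)` with respect to surface measure. (The 2-dimensional
Hausdorff measure of Mathlib is a constant multiple of the surface measure.) -/
def HasTrace (U S : Set (Euc 3)) (u g : Euc 3 → ℝ) : Prop :=
  MemH1 U u ∧ ∃ φ : ℕ → Euc 3 → ℝ,
    (∀ k, ContDiff ℝ ∞ (φ k)) ∧
    TendstoL2 (volume.restrict U) φ u ∧
    (∀ i, TendstoL2 (volume.restrict U) (fun k => partialDeriv i (φ k)) (weakPartial U i u)) ∧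
    TendstoL2 ((Measure.hausdorffMeasure 2).restrict S) φ g

/-- `w ∈ H²₀(U)`: `w` is a limit in `H²(U)` of functions in `C_c^∞(U)`. -/
def MemH20 {n : ℕ} (U : Set (Euc n)) (w : Euc n → ℝ) : Prop :=
  MemH2 U w ∧ ∃ φ : ℕ → Euc n → ℝ,
    (∀ k, IsTestFunction U (φ k)) ∧
    TendstoL2 (volume.restrict U) φ w ∧
    (∀ i, TendstoL2 (volume.restrict U) (fun k => partialDeriv i (φ k)) (weakPartial U i w)) ∧
    (∀ i j, TendstoL2 (volume.restrict U) (fun k => partialDeriv i (partialDeriv j (φ k)))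
      (weakPartial U i (weakPartial U j w)))

/-- `U` has smooth boundary: near each boundary point, `U` is the sublevel set `{ρ < 0}` of a
smooth function `ρ` whose derivative does not vanish there. -/
def HasSmoothBoundary {n : ℕ} (U : Set (Euc n)) : Prop :=
  ∀ x ∈ frontier U, ∃ V : Set (Euc n), IsOpen V ∧ x ∈ V ∧ ∃ ρ : Euc n → ℝ,
    ContDiffOn ℝ ∞ ρ V ∧ fderiv ℝ ρ x ≠ 0 ∧ ∀ y ∈ V, (y ∈ U ↔ ρ y < 0)

/-- The geometric setting: an acoustic chamber `Ω ⊆ ℝ³` whose boundary consists of a rigid wall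
`Γ₀` and a flat elastic wall `Γ`. As `Γ` lies in a plane, it is given in Cartesian coordinates of
that plane: `Γ = e(D)` for an isometric affine embedding `e : ℝ² → ℝ³` and a planar domain `D`. -/
structure AcousticChamber where
  Ω : Set (Euc 3)
  Γ₀ : Set (Euc 3)
  D : Set (Euc 2)
  e : Euc 2 →ᵃⁱ[ℝ] Euc 3
  isOpen_Ω : IsOpen Ω
  isConnected_Ω : IsConnected Ω
  isBounded_Ω : Bornology.IsBounded Ω
  smooth_Ω : HasSmoothBoundary Ω
  frontier_eq : frontier Ω = closure (Γ₀ ∪ e '' D)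
  disjoint_walls : Disjoint Γ₀ (e '' D)
  /-- `Γ₀` and `Γ` are open in `∂Ω`; `D` is open in the plane. -/
  relOpen_Γ₀ : ∃ V, IsOpen V ∧ Γ₀ = frontier Ω ∩ V
  relOpen_Γ : ∃ V, IsOpen V ∧ e '' D = frontier Ω ∩ V
  isOpen_D : IsOpen D
  isConnected_Γ₀ : IsConnected Γ₀
  isConnected_D : IsConnected D
  measure_Γ₀_pos : 0 < Measure.hausdorffMeasure 2 Γ₀
  measure_Γ_pos : 0 < Measure.hausdorffMeasure 2 (e '' D)
  /-- The boundaries of `Γ₀` and `Γ` relative to `∂Ω` are the same curve, and it is smooth. -/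
  edge_eq : closure Γ₀ \ Γ₀ = closure (e '' D) \ (e '' D)
  smooth_D : HasSmoothBoundary D

namespace AcousticChamber

variable (A : AcousticChamber)

/-- `L²(Ω) × L²(Γ)`. Integration over the flat wall `Γ` is Lebesgue integration over `D`. -/
abbrev Pair : Type :=
  Lp ℝ 2 ((volume : Measure (Euc 3)).restrict A.Ω) ×
    Lp ℝ 2 ((volume : Measure (Euc 2)).restrict A.D)

/-- `X = H¹_{Γ₀}(Ω) × H²₀(Γ)`, where `H¹_{Γ₀}(Ω)` consists of the `u ∈ H¹(Ω)` with zero trace on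
`Γ₀`. -/
def X : Set A.Pair :=
  {z | HasTrace A.Ω A.Γ₀ z.1 0 ∧ MemH20 A.D z.2}

/-- `‖∇u‖₂² + |Δw|₂²`. -/
def normXSq (z : A.Pair) : ℝ :=
  (∫ x in A.Ω, ∑ i, weakPartial A.Ω i z.1 x ^ 2) + ∫ y in A.D, weakLaplacian A.D z.2 y ^ 2

/-- The norm of `X`. -/
def normX (z : A.Pair) : ℝ := Real.sqrt (A.normXSq z)

/-- `∫_Ω |u|^{p+1} log|u| + ∫_Γ |w|^{p+1} log|w|`; the integrand is `0` where the function is. -/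
def logTerm (p : ℝ) (z : A.Pair) : ℝ :=
  (∫ x in A.Ω, |z.1 x| ^ (p + 1) * Real.log |z.1 x|) +
    ∫ y in A.D, |z.2 y| ^ (p + 1) * Real.log |z.2 y|

/-- `‖u‖_{p+1}^{p+1} + |w|_{p+1}^{p+1}`. -/
def powTerm (p : ℝ) (z : A.Pair) : ℝ :=
  (∫ x in A.Ω, |z.1 x| ^ (p + 1)) + ∫ y in A.D, |z.2 y| ^ (p + 1)

/-- The potential energy functional. -/
def J (p : ℝ) (z : A.Pair) : ℝ :=
  1 / 2 * A.normXSq z - 1 / (p + 1) * A.logTerm p z + 1 / (p + 1) ^ 2 * A.powTerm p z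

/-- The Nehari functional. -/
def I (p : ℝ) (z : A.Pair) : ℝ := A.normXSq z - A.logTerm p z

/-- The Nehari manifold. -/
def nehari (p : ℝ) : Set A.Pair := {z | z ∈ A.X ∧ z ≠ 0 ∧ A.I p z = 0}

/-- The depth of the potential well, an infimum in the extended reals. -/
def depth (p : ℝ) : EReal := ⨅ z ∈ A.nehari p, (A.J p z : EReal)

/-- The potential well. -/
def W (p : ℝ) : Set A.Pair := {z | z ∈ A.X ∧ (A.J p z : EReal) < A.depth p}

/-- The stable part of the potential well. -/
def W₁ (p : ℝ) : Set A.Pair := {z | z ∈ A.W p ∧ 0 < A.I p z} ∪ {0}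

/-- The open ball `B_r(0,0)` of `X`. -/
def ballX (r : ℝ) : Set A.Pair := {z | z ∈ A.X ∧ A.normX z < r}

end AcousticChamber

end

/-! Write `N` for the square of the `X`-norm. Everything rests on the embeddings of both factors of
`X` into `L⁶`, with `‖∇u‖₂` and `‖Δw‖₂` as the only norms on the right.

Since `1 < p < 5`, one has `s^(p+1) log s ≤ s⁶/(5-p)` and `-s^(p+1) log s ≤ s²/(p-1)`. With the
embeddings, the logarithmic term is at most `K N³` and at least `-K N`. Hence `I ≥ N - K N³ > 0` for
small `N > 0`, so the Nehari manifold stays away from the origin: `N ≥ 1/K` there. On it `J ≥ (1/2 -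
1/(p+1)) N`, which gives a positive lower bound for `d`. Near the origin `J ≤ 4 K N`, so a small
ball satisfies both `J < d` and, off zero, `I > 0`. A small multiple of a bump function in `Ω` shows
that the ball is not just the origin.

For `u`, the embedding combines a Sobolev inequality on `Ω` (`exists_sobolev`) with a Poincaré
inequality (`isControlled_self`), both proved for smooth functions and passed to the limit. Neither
uses an extension operator or boundary flattening: near each point of the closure there is a basis
of directions leading into `Ω`, so integrating along these directions never leaves the domain. For
`w`, test functions extend by zero, the planar Sobolev inequality applies, and `‖∇φ‖₂² ≤ ‖φ‖₂ ‖Δφ‖₂`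
removes the gradient. -/

/-! ### Inward directions at the boundary -/

/-- Inside the ball `B_R(x₀)`, the direction `v` leads from the closure of `U` into `U`. -/
def IsInward {n : ℕ} (U : Set (Euc n)) (x₀ v : Euc n) (R : ℝ) : Prop :=
  ∀ y ∈ closure U ∩ Metric.ball x₀ R, ∀ t : ℝ, 0 < t → y + t • v ∈ Metric.ball x₀ R → y + t • v ∈ U

/-- An open half-space spans: adding a large multiple of a vector `w` with `ℓ w < 0` moves any `v`
into it. A basis can therefore be extracted from the half-space. -/
theorem exists_basis_neg {n : ℕ} {ℓ : Euc n →L[ℝ] ℝ} (hℓ : ℓ ≠ 0) :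
    ∃ b : Module.Basis (Fin n) ℝ (Euc n), ∀ i, ℓ (b i) < 0 := by
  obtain ⟨w, hw⟩ : ∃ w, ℓ w < 0 := by
    obtain ⟨w, hw⟩ : ∃ w, ℓ w ≠ 0 := by
      by_contra! h
      exact hℓ (ContinuousLinearMap.ext h)
    rcases lt_or_gt_of_ne hw with h | h
    · exact ⟨w, h⟩
    · exact ⟨-w, by simpa using h⟩
  have hspan : ⊤ ≤ Submodule.span ℝ {v : Euc n | ℓ v < 0} := by
    intro v _
    have hv : v = (v + ((|ℓ v| + 1) / (-ℓ w)) • w) - ((|ℓ v| + 1) / (-ℓ w)) • w := by simp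
    rw [hv]
    refine Submodule.sub_mem _ (Submodule.subset_span ?_)
      (Submodule.smul_mem _ _ (Submodule.subset_span hw))
    have : (|ℓ v| + 1) / (-ℓ w) * ℓ w = -(|ℓ v| + 1) := by
      field_simp [hw.ne]
    simp only [Set.mem_ofPred_eq, map_add, map_smul, smul_eq_mul, this]
    linarith [le_abs_self (ℓ v)]
  let b := Module.Basis.ofSpan hspan
  refine ⟨b.reindex (b.indexEquiv (EuclideanSpace.basisFun (Fin n) ℝ).toBasis), fun i => ?_⟩
  rw [Module.Basis.reindex_apply]
  exact Module.Basis.ofSpan_subset hspan ⟨_, rfl⟩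

/-- At a point of `U` any basis works. At a boundary point, take basis vectors on which the
derivative of the defining function `ρ` is negative; by continuity this persists on a ball. Points
of the closure in that ball have `ρ ≤ 0`, and `ρ` strictly decreases along the segments, so their
endpoints lie in `{ρ < 0}`. -/
theorem exists_inward_basis {n : ℕ} {U : Set (Euc n)} (hU : IsOpen U) (hs : HasSmoothBoundary U)
    {x₀ : Euc n} (hx₀ : x₀ ∈ closure U) :
    ∃ R > 0, ∃ b : Module.Basis (Fin n) ℝ (Euc n), ∀ i, IsInward U x₀ (b i) R := by
  by_cases hxU : x₀ ∈ U
  · obtain ⟨R, hR, hball⟩ := Metric.isOpen_iff.1 hU x₀ hxU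
    exact ⟨R, hR, (EuclideanSpace.basisFun (Fin n) ℝ).toBasis, fun i y _ t _ h => hball h⟩
  obtain ⟨V, hV, hxV, ρ, hρ, hρ0, hVU⟩ := hs x₀ ⟨hx₀, by rwa [hU.interior_eq]⟩
  obtain ⟨b, hb⟩ := exists_basis_neg hρ0
  have hcont : ContinuousOn (fderiv ℝ ρ) V := hρ.continuousOn_fderiv_of_isOpen hV (by simp)
  have hev : ∀ᶠ y in 𝓝 x₀, y ∈ V ∧ ∀ i, fderiv ℝ ρ y (b i) < 0 := by
    refine (hV.eventually_mem hxV).and (eventually_all.2 fun i => ?_)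
    have : ContinuousAt (fun y => fderiv ℝ ρ y (b i)) x₀ :=
      (hcont.continuousAt (hV.mem_nhds hxV)).clm_apply continuousAt_const
    exact this.eventually_lt continuousAt_const (hb i)
  obtain ⟨R, hR, hball⟩ := Metric.eventually_nhds_iff_ball.1 hev
  refine ⟨R, hR, b, fun i y hy t ht hyt => ?_⟩
  have hyρ : ρ y ≤ 0 := by
    by_contra! hpos
    have hyV := (hball y hy.2).1
    have h1 : ∀ᶠ z in 𝓝 y, z ∈ V ∧ 0 < ρ z :=
      (hV.eventually_mem hyV).and
        (continuousAt_const.eventually_lt (hρ.continuousOn.continuousAt (hV.mem_nhds hyV)) hpos)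
    obtain ⟨z, hz, hzU⟩ := mem_closure_iff_nhds.1 hy.1 _ h1
    exact absurd ((hVU z hz.1).1 hzU) (not_lt.2 hz.2.le)
  have hseg : ∀ s ∈ Set.Icc 0 t, y + s • b i ∈ Metric.ball x₀ R := by
    intro s hs
    have := (convex_ball x₀ R).add_smul_mem hy.2 hyt (t := s / t)
      ⟨div_nonneg hs.1 ht.le, (div_le_one ht).2 hs.2⟩
    rwa [smul_smul, div_mul_cancel₀ _ ht.ne'] at this
  have hder : ∀ s ∈ Set.Icc 0 t,
      HasDerivAt (fun s : ℝ => ρ (y + s • b i)) (fderiv ℝ ρ (y + s • b i) (b i)) s := by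
    intro s hs
    have hz := (hball _ (hseg s hs)).1
    have h1 : HasFDerivAt ρ (fderiv ℝ ρ (y + s • b i)) (y + s • b i) :=
      ((hρ.contDiffAt (hV.mem_nhds hz)).differentiableAt (by simp)).hasFDerivAt
    have h2 : HasDerivAt (fun s : ℝ => y + s • b i) (b i) s := by
      simpa using ((hasDerivAt_id s).smul_const (b i)).const_add y
    exact h1.comp_hasDerivAt s h2
  have hanti : StrictAntiOn (fun s : ℝ => ρ (y + s • b i)) (Set.Icc 0 t) := by
    refine strictAntiOn_of_deriv_neg (convex_Icc 0 t)
      (fun s hs => (hder s hs).continuousAt.continuousWithinAt) fun s hs => ?_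
    rw [interior_Icc] at hs
    rw [(hder s (Set.Ioo_subset_Icc_self hs)).deriv]
    exact (hball _ (hseg s (Set.Ioo_subset_Icc_self hs))).2 i
  have := hanti (Set.left_mem_Icc.2 ht.le) (Set.right_mem_Icc.2 ht.le) ht
  rw [hVU _ (hball _ hyt).1]
  simp only [zero_smul, add_zero] at this
  linarith

/-! ### Cauchy–Schwarz and integration along segments -/

theorem sq_lintegral_mul_le {α : Type*} [MeasurableSpace α] (μ : Measure α) {f g : α → ℝ≥0∞}
    (hf : AEMeasurable f μ) (hg : AEMeasurable g μ) :
    (∫⁻ a, f a * g a ∂μ) ^ 2 ≤ (∫⁻ a, f a ^ 2 ∂μ) * ∫⁻ a, g a ^ 2 ∂μ := by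
  have h := ENNReal.lintegral_mul_le_Lp_mul_Lq μ Real.HolderConjugate.two_two hf hg
  calc (∫⁻ a, f a * g a ∂μ) ^ 2
      ≤ ((∫⁻ a, f a ^ (2 : ℝ) ∂μ) ^ (1 / 2 : ℝ) * (∫⁻ a, g a ^ (2 : ℝ) ∂μ) ^ (1 / 2 : ℝ)) ^ 2 := by
        gcongr
        exact h
    _ = _ := by
      rw [mul_pow, ← ENNReal.rpow_natCast, ← ENNReal.rpow_natCast, ← ENNReal.rpow_mul,
        ← ENNReal.rpow_mul]
      simp

theorem sq_lintegral_le {α : Type*} [MeasurableSpace α] (μ : Measure α) {f : α → ℝ≥0∞}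
    (hf : AEMeasurable f μ) : (∫⁻ a, f a ∂μ) ^ 2 ≤ μ Set.univ * ∫⁻ a, f a ^ 2 ∂μ := by
  simpa [mul_comm] using sq_lintegral_mul_le μ hf (aemeasurable_const (b := (1 : ℝ≥0∞)))

theorem ENNReal.add_sq_le_two_mul (a b : ℝ≥0∞) : (a + b) ^ 2 ≤ 2 * (a ^ 2 + b ^ 2) := by
  have := ENNReal.rpow_add_le_mul_rpow_add_rpow a b (p := 2) (by norm_num)
  norm_num at this
  exact this

theorem enorm_sub_le_lintegral_fderiv {n : ℕ} {φ : Euc n → ℝ} (hφ : ContDiff ℝ 1 φ) (x v : Euc n)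
    {s : ℝ} (hs : 0 ≤ s) :
    ‖φ (x + s • v) - φ x‖ₑ ≤ ∫⁻ t in Set.Ioo 0 s, ‖fderiv ℝ φ (x + t • v)‖ₑ * ‖v‖ₑ := by
  have hder : ∀ t : ℝ, HasDerivAt (fun t : ℝ => φ (x + t • v)) (fderiv ℝ φ (x + t • v) v) t := by
    intro t
    have h1 := (hφ.differentiable (by simp) (x + t • v)).hasFDerivAt
    have h2 : HasDerivAt (fun s : ℝ => x + s • v) v t := by
      simpa using ((hasDerivAt_id t).smul_const v).const_add x
    exact h1.comp_hasDerivAt t h2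
  have hc : Continuous fun t : ℝ => fderiv ℝ φ (x + t • v) v := by
    have := hφ.continuous_fderiv (by simp)
    fun_prop
  have h := intervalIntegral.integral_eq_sub_of_hasDerivAt (a := 0) (b := s)
    (fun t _ => hder t) (hc.intervalIntegrable _ _)
  rw [zero_smul, add_zero] at h
  rw [← h, intervalIntegral.integral_of_le hs, restrict_Ioo_eq_restrict_Ioc.symm]
  refine (enorm_integral_le_lintegral_enorm _).trans (lintegral_mono fun t => ?_)
  exact ContinuousLinearMap.le_opENorm _ _

/-- The fundamental theorem of calculus along the segment, followed by Cauchy–Schwarz in `t`. The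
indicator of `Ω` allows the integral to run over all of `(0, 1)`, so that the last term no longer
depends on `s`. -/
theorem enorm_sq_le_of_segment {n : ℕ} {Ω : Set (Euc n)} (hΩ : IsOpen Ω) {φ : Euc n → ℝ}
    (hφ : ContDiff ℝ 1 φ) (x v : Euc n) {s : ℝ} (hs : 0 ≤ s) (hs1 : s ≤ 1)
    (hseg : ∀ t ∈ Set.Ioo 0 s, x + t • v ∈ Ω) :
    ‖φ x‖ₑ ^ 2 ≤ 2 * ‖φ (x + s • v)‖ₑ ^ 2 + 2 * ‖v‖ₑ ^ 2 *
      ∫⁻ t in Set.Ioo (0 : ℝ) 1, Ω.indicator (fun y => ‖fderiv ℝ φ y‖ₑ ^ 2) (x + t • v) := by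
  set D := ∫⁻ t in Set.Ioo (0 : ℝ) 1, Ω.indicator (fun y => ‖fderiv ℝ φ y‖ₑ) (x + t • v) with hD
  have hmeas : Measurable fun t : ℝ => Ω.indicator (fun y => ‖fderiv ℝ φ y‖ₑ) (x + t • v) := by
    have := hφ.continuous_fderiv (by simp)
    exact (this.enorm.measurable.indicator hΩ.measurableSet).comp (by fun_prop)
  have h1 : ‖φ x‖ₑ ≤ ‖φ (x + s • v)‖ₑ + ‖v‖ₑ * D := by
    have h2 : ‖φ (x + s • v) - φ x‖ₑ ≤ ‖v‖ₑ * D := by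
      refine (enorm_sub_le_lintegral_fderiv hφ x v hs).trans ?_
      rw [hD, ← lintegral_const_mul _ hmeas]
      calc _ = ∫⁻ t in Set.Ioo (0 : ℝ) s,
            ‖v‖ₑ * Ω.indicator (fun y => ‖fderiv ℝ φ y‖ₑ) (x + t • v) := by
            refine setLIntegral_congr_fun measurableSet_Ioo fun t ht => ?_
            rw [Set.indicator_of_mem (hseg t ht), mul_comm]
        _ ≤ _ := lintegral_mono_set (Set.Ioo_subset_Ioo_right hs1)
    calc ‖φ x‖ₑ = ‖φ (x + s • v) - (φ (x + s • v) - φ x)‖ₑ := by simp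
      _ ≤ ‖φ (x + s • v)‖ₑ + ‖φ (x + s • v) - φ x‖ₑ := enorm_sub_le
      _ ≤ _ := by gcongr
  have h3 : D ^ 2 ≤ ∫⁻ t in Set.Ioo (0 : ℝ) 1,
      Ω.indicator (fun y => ‖fderiv ℝ φ y‖ₑ ^ 2) (x + t • v) := by
    refine (sq_lintegral_le _ hmeas.aemeasurable).trans ?_
    simp only [MeasurableSet.univ, Measure.restrict_apply, Set.univ_inter, Real.volume_Ioo,
      sub_zero, ENNReal.ofReal_one, one_mul]
    refine lintegral_mono fun t => ?_
    by_cases h : x + t • v ∈ Ω <;> simp [h]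
  calc ‖φ x‖ₑ ^ 2 ≤ (‖φ (x + s • v)‖ₑ + ‖v‖ₑ * D) ^ 2 := by gcongr
    _ ≤ 2 * (‖φ (x + s • v)‖ₑ ^ 2 + (‖v‖ₑ * D) ^ 2) := ENNReal.add_sq_le_two_mul _ _
    _ ≤ _ := by
      rw [mul_add, mul_pow, mul_assoc]
      gcongr

/-- Integrate the pointwise bound over `E` and exchange the integrals: for each fixed `t`,
translation invariance turns the gradient term into its integral over `Ω`. The stopping time `σ` may
vary with the point, which is needed when it is the exit time from `Ω`. -/
theorem setLIntegral_sq_le_of_segment {n : ℕ} {Ω E : Set (Euc n)} (hΩ : IsOpen Ω)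
    {φ : Euc n → ℝ} (hφ : ContDiff ℝ 1 φ) (v : Euc n) (σ : Euc n → ℝ) (hσ : Measurable σ)
    (hE : MeasurableSet E)
    (hσE : ∀ x ∈ E, 0 ≤ σ x ∧ σ x ≤ 1 ∧ ∀ t ∈ Set.Ioo 0 (σ x), x + t • v ∈ Ω) :
    ∫⁻ x in E, ‖φ x‖ₑ ^ 2 ≤ 2 * (∫⁻ x in E, ‖φ (x + σ x • v)‖ₑ ^ 2) +
      2 * ‖v‖ₑ ^ 2 * ∫⁻ x in Ω, ‖fderiv ℝ φ x‖ₑ ^ 2 := by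
  set F : Euc n → ℝ≥0∞ := Ω.indicator (fun y => ‖fderiv ℝ φ y‖ₑ ^ 2) with hF
  have hFm : Measurable F := by
    have := hφ.continuous_fderiv (by simp)
    exact (this.enorm.measurable.pow_const 2).indicator hΩ.measurableSet
  have hg : Measurable fun x => ‖φ (x + σ x • v)‖ₑ ^ 2 := by
    have := hφ.continuous.measurable
    fun_prop
  have hjoint : Measurable fun q : Euc n × ℝ => F (q.1 + q.2 • v) := hFm.comp (by fun_prop)
  calc ∫⁻ x in E, ‖φ x‖ₑ ^ 2
      ≤ ∫⁻ x in E, (2 * ‖φ (x + σ x • v)‖ₑ ^ 2 +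
          2 * ‖v‖ₑ ^ 2 * ∫⁻ t in Set.Ioo (0 : ℝ) 1, F (x + t • v)) :=
        setLIntegral_mono' hE fun x hx =>
          enorm_sq_le_of_segment hΩ hφ x v (hσE x hx).1 (hσE x hx).2.1 (hσE x hx).2.2
    _ = 2 * (∫⁻ x in E, ‖φ (x + σ x • v)‖ₑ ^ 2) +
          2 * ‖v‖ₑ ^ 2 * ∫⁻ x in E, ∫⁻ t in Set.Ioo (0 : ℝ) 1, F (x + t • v) := by
        rw [lintegral_add_left (by fun_prop), lintegral_const_mul _ hg,
          lintegral_const_mul _ hjoint.lintegral_prod_right']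
    _ ≤ 2 * (∫⁻ x in E, ‖φ (x + σ x • v)‖ₑ ^ 2) +
          2 * ‖v‖ₑ ^ 2 * ∫⁻ x, ∫⁻ t in Set.Ioo (0 : ℝ) 1, F (x + t • v) := by
        gcongr
        exact Measure.restrict_le_self
    _ = _ := by
        rw [lintegral_lintegral_swap hjoint.aemeasurable]
        simp_rw [lintegral_add_right_eq_self F]
        simp [hF, lintegral_indicator hΩ.measurableSet]

/-! ### The Poincaré inequality -/

/-- The `L²` norm on `E` of a smooth function is bounded by that of its gradient on `Ω` and that of
its restriction to `S`. -/
def IsControlled {n : ℕ} (Ω S E : Set (Euc n)) : Prop :=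
  ∃ C : NNReal, ∀ φ : Euc n → ℝ, ContDiff ℝ 1 φ →
    ∫⁻ x in E, ‖φ x‖ₑ ^ 2 ≤ C * ((∫⁻ x in Ω, ‖fderiv ℝ φ x‖ₑ ^ 2) +
      ∫⁻ x in S, ‖φ x‖ₑ ^ 2 ∂Measure.hausdorffMeasure 2)

theorem IsControlled.mono {n : ℕ} {Ω S E F : Set (Euc n)} (h : IsControlled Ω S F) (hEF : E ⊆ F) :
    IsControlled Ω S E := by
  obtain ⟨C, hC⟩ := h
  exact ⟨C, fun φ hφ => (lintegral_mono_set hEF).trans (hC φ hφ)⟩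

theorem IsControlled.union {n : ℕ} {Ω S E F : Set (Euc n)} (h : IsControlled Ω S E)
    (h' : IsControlled Ω S F) : IsControlled Ω S (E ∪ F) := by
  obtain ⟨C, hC⟩ := h
  obtain ⟨C', hC'⟩ := h'
  refine ⟨C + C', fun φ hφ => (lintegral_union_le _ _ _).trans ?_⟩
  rw [ENNReal.coe_add, add_mul]
  exact add_le_add (hC φ hφ) (hC' φ hφ)

/-- The segment estimate with constant stopping time 1: control is inherited backwards along a
translation whose path stays in `Ω`. -/
theorem IsControlled.of_translate {n : ℕ} {Ω S E F : Set (Euc n)} (hΩ : IsOpen Ω)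
    (hE : MeasurableSet E) (v : Euc n) (hF : IsControlled Ω S F) (hEF : ∀ x ∈ E, x + v ∈ F)
    (hseg : ∀ x ∈ E, ∀ t ∈ Set.Ioo (0 : ℝ) 1, x + t • v ∈ Ω) : IsControlled Ω S E := by
  obtain ⟨C, hC⟩ := hF
  refine ⟨2 * C + 2 * ‖v‖₊ ^ 2, fun φ hφ => ?_⟩
  refine (setLIntegral_sq_le_of_segment hΩ hφ v (fun _ => 1) measurable_const hE
    fun x hx => ⟨zero_le_one, le_rfl, hseg x hx⟩).trans ?_
  simp only [one_smul]
  have h1 : ∫⁻ x in E, ‖φ (x + v)‖ₑ ^ 2 ≤ ∫⁻ x in F, ‖φ x‖ₑ ^ 2 := by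
    have hm : MeasurePreserving (fun x : Euc n => x + v) volume volume :=
      measurePreserving_add_right _ v
    rw [← lintegral_map (μ := volume.restrict E) (f := fun x => ‖φ x‖ₑ ^ 2)
      (hφ.continuous.enorm.measurable.pow_const 2) (by fun_prop)]
    refine lintegral_mono' (Measure.le_iff.2 fun s hs => ?_) le_rfl
    rw [Measure.map_apply (by fun_prop) hs, Measure.restrict_apply (hs.preimage (by fun_prop)),
      Measure.restrict_apply hs]
    have hsub : (fun x => x + v) ⁻¹' s ∩ E ⊆ (fun x => x + v) ⁻¹' (s ∩ F) :=
      fun x hx => ⟨hx.1, hEF x hx.2⟩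
    exact (measure_mono hsub).trans
      (hm.measure_preimage_emb (MeasurableEquiv.addRight v).measurableEmbedding (s ∩ F)).le
  set G := ∫⁻ x in Ω, ‖fderiv ℝ φ x‖ₑ ^ 2
  set T := ∫⁻ x in S, ‖φ x‖ₑ ^ 2 ∂Measure.hausdorffMeasure 2
  calc 2 * (∫⁻ x in E, ‖φ (x + v)‖ₑ ^ 2) + 2 * ‖v‖ₑ ^ 2 * G
      ≤ 2 * (C * (G + T)) + 2 * ‖v‖ₑ ^ 2 * (G + T) := by
        gcongr
        · exact h1.trans (hC φ hφ)
        · exact le_self_add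
    _ = _ := by
        simp only [ENNReal.coe_add, ENNReal.coe_mul, ENNReal.coe_pow, enorm, ENNReal.coe_ofNat]
        ring

theorem exists_volume_eq_smul_map {n : ℕ} (b : Module.Basis (Fin n) ℝ (Euc n)) :
    ∃ c : NNReal, (volume : Measure (Euc n)) =
      c • (volume : Measure (Fin n → ℝ)).map b.equivFun.toContinuousLinearEquiv.symm := by
  have : Measure.IsAddHaarMeasure
      ((volume : Measure (Fin n → ℝ)).map b.equivFun.toContinuousLinearEquiv.symm) :=
    ContinuousLinearEquiv.isAddHaarMeasure_map _ _
  exact ⟨_, Measure.isAddLeftInvariant_eq_smul ..⟩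

-- The exit time is lower semicontinuous: for `a < 1`, the points that exit by time `a` form the sum
-- of the closed set `Ωᶜ` and a compact segment. The added point 1 keeps the set nonempty, so the
-- infimum never takes its default value.
open scoped Pointwise in
theorem measurable_sInf_exit {n : ℕ} {Ω : Set (Euc n)} (hΩ : IsOpen Ω) (v : Euc n) :
    Measurable fun x : Euc n => sInf ({t : ℝ | t ∈ Set.Icc 0 1 ∧ x + t • v ∉ Ω} ∪ {1}) := by
  have hcpt : ∀ x, IsCompact ({t : ℝ | t ∈ Set.Icc 0 1 ∧ x + t • v ∉ Ω} ∪ {1}) := by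
    intro x
    refine IsCompact.union ?_ isCompact_singleton
    have : IsClosed ((fun t : ℝ => x + t • v) ⁻¹' Ωᶜ) := hΩ.isClosed_compl.preimage (by fun_prop)
    exact isCompact_Icc.inter_right this
  refine measurable_of_Iic fun a => ?_
  by_cases ha : 1 ≤ a
  · convert! MeasurableSet.univ
    refine Set.eq_univ_of_forall fun x => ?_
    exact (csInf_le (hcpt x).bddBelow (Or.inr rfl)).trans ha
  · have : (fun x : Euc n => sInf ({t : ℝ | t ∈ Set.Icc 0 1 ∧ x + t • v ∉ Ω} ∪ {1})) ⁻¹' Set.Iic a =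
        Ωᶜ + (fun t : ℝ => -(t • v)) '' Set.Icc 0 a := by
      ext x
      constructor
      · intro hx
        have hx : sInf ({t : ℝ | t ∈ Set.Icc 0 1 ∧ x + t • v ∉ Ω} ∪ {1}) ≤ a := hx
        rcases (hcpt x).sInf_mem ⟨1, Or.inr rfl⟩ with h | h
        · exact ⟨_, h.2, _, ⟨_, ⟨h.1.1, hx⟩, rfl⟩, by simp⟩
        · exact absurd (h ▸ hx) ha
      · rintro ⟨y, hy, _, ⟨t, ht, rfl⟩, rfl⟩
        refine (csInf_le (hcpt _).bddBelow (Or.inl ⟨⟨ht.1, ht.2.trans (not_le.1 ha).le⟩, ?_⟩)).trans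
          ht.2
        simpa using hy
    rw [this]
    exact (hΩ.isClosed_compl.add_right_of_isCompact
      (isCompact_Icc.image (by fun_prop))).measurableSet

/-- The projection along the first vector of a basis does not increase Hausdorff measure much, and
a bounded cylinder has volume comparable to the area of its base. -/
theorem exists_volume_le_hausdorffMeasure (b : Module.Basis (Fin 3) ℝ (Euc 3)) {B : Set (Euc 3)}
    (hB : Bornology.IsBounded B) :
    ∃ C : NNReal, ∀ E F : Set (Euc 3), E ⊆ B → (∀ x ∈ E, ∃ t : ℝ, x + t • b 0 ∈ F) →
      volume E ≤ C * Measure.hausdorffMeasure 2 F := by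
  obtain ⟨c, hc⟩ := exists_volume_eq_smul_map b
  set T := b.equivFun.toContinuousLinearEquiv with hT
  let P : Euc 3 →L[ℝ] (Fin 2 → ℝ) :=
    ContinuousLinearMap.pi fun j =>
      (ContinuousLinearMap.proj (R := ℝ) (φ := fun _ : Fin 3 => ℝ) j.succ).comp
      (T : Euc 3 →L[ℝ] (Fin 3 → ℝ))
  have hTb : T (b 0) = Pi.single 0 1 := by
    ext i
    simp [hT, Pi.single_apply, eq_comm]
  have hPb : P (b 0) = 0 := by
    ext j
    simp [P, hTb]
  obtain ⟨M, hM0, hM⟩ : ∃ M : ℝ, 0 ≤ M ∧ ∀ x ∈ B, |T x 0| ≤ M := by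
    obtain ⟨r, hr⟩ := hB.exists_norm_le
    refine ⟨‖(T : Euc 3 →L[ℝ] Fin 3 → ℝ)‖ * |r|, by positivity, fun x hx => ?_⟩
    calc |T x 0| ≤ ‖(T : Euc 3 →L[ℝ] Fin 3 → ℝ) x‖ := norm_le_pi_norm (T x) 0
      _ ≤ _ := (ContinuousLinearMap.le_opNorm _ _).trans
        (by gcongr; exact (hr x hx).trans (le_abs_self r))
  refine ⟨c * (2 * M).toNNReal * ‖P‖₊ ^ 2, fun E F hEB hEF => ?_⟩
  have hproj : P '' E ⊆ P '' F := by
    rintro _ ⟨x, hx, rfl⟩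
    obtain ⟨t, ht⟩ := hEF x hx
    exact ⟨_, ht, by simp [hPb]⟩
  -- A linear map `P` multiplies two-dimensional Hausdorff measure by at most `‖P‖²`, and in the
  -- plane with the sup norm this measure is Lebesgue measure.
  have harea : volume (P '' F) ≤ (‖P‖₊ : ℝ≥0∞) ^ 2 * Measure.hausdorffMeasure 2 F := by
    have h := P.lipschitz.hausdorffMeasure_image_le (d := 2) (by norm_num) F
    have h2 : (Measure.hausdorffMeasure 2 : Measure (Fin 2 → ℝ)) = volume := by
      simpa using hausdorffMeasure_pi_real (ι := Fin 2)
    rw [h2] at h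
    simpa using h
  have hcyl : (volume : Measure (Fin 3 → ℝ)) (T '' E) ≤
      ENNReal.ofReal (2 * M) * volume (P '' F) := by
    have hmp := volume_preserving_piFinSuccAbove (fun _ : Fin 3 => ℝ) 0
    calc (volume : Measure (Fin 3 → ℝ)) (T '' E)
        ≤ volume ((MeasurableEquiv.piFinSuccAbove (fun _ : Fin 3 => ℝ) 0) ⁻¹'
            (Set.Icc (-M) M ×ˢ (P '' F))) := by
          refine measure_mono ?_
          rintro _ ⟨x, hx, rfl⟩
          refine ⟨abs_le.1 (hM x (hEB hx)), ?_⟩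
          convert! hproj ⟨x, hx, rfl⟩ using 1
      _ = volume (Set.Icc (-M) M ×ˢ (P '' F)) := hmp.measure_preimage_equiv _
      _ = _ := by
          rw [Measure.volume_eq_prod, Measure.prod_prod, Real.volume_Icc]
          congr 2
          ring
  calc volume E = c * volume (T '' E) := by
        conv_lhs => rw [hc]
        have h := T.symm.toHomeomorph.toMeasurableEquiv.map_apply (μ := volume) E
        rw [Homeomorph.toMeasurableEquiv_coe, ContinuousLinearEquiv.coe_toHomeomorph] at h
        rw [Measure.smul_apply, h, ← T.image_eq_preimage_symm]
        rfl
    _ ≤ c * (ENNReal.ofReal (2 * M) * ((‖P‖₊ : ℝ≥0∞) ^ 2 * Measure.hausdorffMeasure 2 F)) := by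
        gcongr
        exact hcyl.trans (by gcongr)
    _ = _ := by
        rw [ENNReal.ofReal]
        push_cast
        ring

/-- Close to `x₀`, a small ball inside `Ω` can be translated along `b 0` to the outside. Each of its
points then crosses the given boundary patch, and the value at the crossing plus a gradient integral
bounds the value at the point. -/
theorem exists_isControlled_ball {Ω V : Set (Euc 3)} (hΩ : IsOpen Ω) (hs : HasSmoothBoundary Ω)
    (hV : IsOpen V) {x₀ : Euc 3} (hx₀ : x₀ ∈ frontier Ω ∩ V) :
    ∃ x₁ ∈ Ω, ∃ δ > 0, IsControlled Ω (frontier Ω ∩ V) (Metric.ball x₁ δ) := by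
  obtain ⟨R, hR, b, hb⟩ := exists_inward_basis hΩ hs (frontier_subset_closure hx₀.1)
  have hx₀Ω : x₀ ∉ Ω := by
    have := hx₀.1.2
    rwa [hΩ.interior_eq] at this
  obtain ⟨R', hR', hball⟩ := Metric.isOpen_iff.1 (hV.inter Metric.isOpen_ball) x₀
    ⟨hx₀.2, Metric.mem_ball_self hR⟩
  obtain ⟨τ, hτ, hτb⟩ : ∃ τ : ℝ, 0 < τ ∧ τ * ‖b 0‖ < R' := by
    refine ⟨R' / (‖b 0‖ + 1), by positivity, ?_⟩
    rw [div_mul_eq_mul_div, div_lt_iff₀ (by positivity)]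
    nlinarith
  have hmem : ∀ s : ℝ, |s| ≤ τ → x₀ + s • b 0 ∈ Metric.ball x₀ R' := by
    intro s hs
    rw [mem_ball_iff_norm, add_sub_cancel_left, norm_smul, Real.norm_eq_abs]
    exact (mul_le_mul_of_nonneg_right hs (norm_nonneg _)).trans_lt hτb
  have hin : x₀ + τ • b 0 ∈ Ω := hb 0 x₀ ⟨frontier_subset_closure hx₀.1, Metric.mem_ball_self hR⟩ τ hτ
    (hball (hmem τ (abs_of_pos hτ).le)).2
  have hout : x₀ + (-τ) • b 0 ∉ closure Ω := by
    intro h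
    refine hx₀Ω ?_
    have := hb 0 _ ⟨h, (hball (hmem (-τ) (by rw [abs_neg, abs_of_pos hτ]))).2⟩ τ hτ
    simp only [neg_smul, neg_add_cancel_right] at this
    exact this (Metric.mem_ball_self hR)
  -- The translation carries `x₀ + τ • b 0`, inside `Ω`, to `x₀ - τ • b 0`, outside its closure.
  set v : Euc 3 := (-(2 * τ)) • b 0 with hv
  have hx₁v : x₀ + τ • b 0 + v = x₀ + (-τ) • b 0 := by
    rw [hv, add_assoc, ← add_smul]
    ring_nf
  have hev : ∀ᶠ x in 𝓝 (x₀ + τ • b 0),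
      x ∈ Ω ∧ x ∈ Metric.ball x₀ R' ∧ x + v ∈ (closure Ω)ᶜ ∧ x + v ∈ Metric.ball x₀ R' := by
    have hc : ContinuousAt (fun x : Euc 3 => x + v) (x₀ + τ • b 0) := by fun_prop
    refine (hΩ.eventually_mem hin).and ((Metric.isOpen_ball.eventually_mem
      (hmem τ (abs_of_pos hτ).le)).and ((hc.eventually_mem ?_).and (hc.eventually_mem ?_)))
    · rw [hx₁v]
      exact isClosed_closure.isOpen_compl.mem_nhds hout
    · rw [hx₁v]
      exact Metric.isOpen_ball.mem_nhds (hmem _ (by rw [abs_neg, abs_of_pos hτ]))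
  obtain ⟨δ, hδ, hδball⟩ := Metric.eventually_nhds_iff_ball.1 hev
  refine ⟨_, hin, δ, hδ, ?_⟩
  set E := Metric.ball (x₀ + τ • b 0) δ
  set σ : Euc 3 → ℝ := fun x => sInf ({t : ℝ | t ∈ Set.Icc 0 1 ∧ x + t • v ∉ Ω} ∪ {1}) with hσ
  have hσm : Measurable σ := measurable_sInf_exit hΩ v
  have hσE : ∀ x ∈ E, 0 ≤ σ x ∧ σ x ≤ 1 ∧ (∀ t ∈ Set.Ioo 0 (σ x), x + t • v ∈ Ω) ∧
      x + σ x • v ∈ frontier Ω ∩ V := by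
    intro x hx
    obtain ⟨hxΩ, hxb, hxv, hxvb⟩ := hδball x hx
    have hZ : {t : ℝ | t ∈ Set.Icc 0 1 ∧ x + t • v ∉ Ω} ∪ {1} =
        {t : ℝ | t ∈ Set.Icc 0 1 ∧ x + t • v ∉ Ω} := by
      refine Set.union_eq_left.2 (Set.singleton_subset_iff.2 ⟨⟨zero_le_one, le_rfl⟩, ?_⟩)
      rw [one_smul]
      exact fun h => hxv (subset_closure h)
    have hcl : IsClosed ((fun t : ℝ => x + t • v) ⁻¹' Ωᶜ) :=
      hΩ.isClosed_compl.preimage (by fun_prop)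
    have hcpt : IsCompact {t : ℝ | t ∈ Set.Icc 0 1 ∧ x + t • v ∉ Ω} := isCompact_Icc.inter_right hcl
    have hσx : σ x = sInf {t : ℝ | t ∈ Set.Icc 0 1 ∧ x + t • v ∉ Ω} := by rw [hσ, ← hZ]
    obtain ⟨⟨h0, h1⟩, hmemσ⟩ : σ x ∈ {t : ℝ | t ∈ Set.Icc 0 1 ∧ x + t • v ∉ Ω} := by
      rw [hσx]
      refine hcpt.sInf_mem ?_
      rw [← hZ]
      exact ⟨1, Or.inr rfl⟩
    have hseg : ∀ t ∈ Set.Ico 0 (σ x), x + t • v ∈ Ω := by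
      intro t ht
      by_contra hcon
      have : σ x ≤ t := hσx ▸ csInf_le hcpt.bddBelow ⟨⟨ht.1, ht.2.le.trans h1⟩, hcon⟩
      exact absurd ht.2 (not_lt.2 this)
    have hσpos : 0 < σ x := by
      refine lt_of_le_of_ne h0 fun h => hmemσ ?_
      rw [← h]
      simpa using hxΩ
    refine ⟨h0, h1, fun t ht => hseg t ⟨ht.1.le, ht.2⟩, ⟨?_, by rwa [hΩ.interior_eq]⟩, ?_⟩
    · have hc : Tendsto (fun t : ℝ => x + t • v) (𝓝[<] σ x) (𝓝 (x + σ x • v)) :=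
        (Continuous.tendsto (by fun_prop) _).mono_left nhdsWithin_le_nhds
      refine mem_closure_of_tendsto hc ?_
      filter_upwards [Ico_mem_nhdsLT hσpos] with t ht using hseg t ht
    · exact (hball ((convex_ball x₀ R').add_smul_mem hxb hxvb ⟨h0, h1⟩)).1
  obtain ⟨C, hC⟩ := exists_volume_le_hausdorffMeasure b (Metric.isBounded_ball (x := x₀ + τ • b 0)
    (r := δ))
  refine ⟨2 * C + 2 * ‖v‖₊ ^ 2, fun φ hφ => ?_⟩
  refine (setLIntegral_sq_le_of_segment hΩ hφ v σ hσm measurableSet_ball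
    fun x hx => ⟨(hσE x hx).1, (hσE x hx).2.1, (hσE x hx).2.2.1⟩).trans ?_
  set G := ∫⁻ x in Ω, ‖fderiv ℝ φ x‖ₑ ^ 2
  set T := ∫⁻ x in frontier Ω ∩ V, ‖φ x‖ₑ ^ 2 ∂Measure.hausdorffMeasure 2
  have hgm : Measurable fun x => x + σ x • v := by fun_prop
  -- The pushforward of volume on `E` under the exit map is at most `C` times the area on the patch:
  -- points exiting in `s` lie over `s` in the direction `b 0`.
  have htrace : ∫⁻ x in E, ‖φ (x + σ x • v)‖ₑ ^ 2 ≤ C * T := by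
    rw [← lintegral_map (μ := volume.restrict E) (f := fun x => ‖φ x‖ₑ ^ 2)
      (hφ.continuous.enorm.measurable.pow_const 2) hgm, ← smul_eq_mul, ← lintegral_smul_measure]
    refine lintegral_mono' (Measure.le_iff.2 fun s hs => ?_) le_rfl
    rw [Measure.map_apply hgm hs, Measure.restrict_apply (hs.preimage hgm), Measure.smul_apply,
      Measure.restrict_apply hs, smul_eq_mul]
    refine hC _ _ Set.inter_subset_right fun x hx => ⟨σ x * -(2 * τ), ?_⟩
    rw [mul_smul]
    exact ⟨hx.1, (hσE x hx.2).2.2.2⟩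
  calc 2 * (∫⁻ x in E, ‖φ (x + σ x • v)‖ₑ ^ 2) + 2 * ‖v‖ₑ ^ 2 * G
      ≤ 2 * (C * (G + T)) + 2 * ‖v‖ₑ ^ 2 * (G + T) := by
        gcongr
        · exact htrace.trans (by gcongr; exact le_add_self)
        · exact le_self_add
    _ = _ := by
        simp only [ENNReal.coe_add, ENNReal.coe_mul, ENNReal.coe_pow, enorm, ENNReal.coe_ofNat]
        ring

/-- The `L²` norm of smooth functions is controlled near `x`. -/
def IsControlledNear {n : ℕ} (Ω S : Set (Euc n)) (x : Euc n) : Prop :=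
  ∃ δ > 0, IsControlled Ω S (Metric.ball x δ)

theorem IsControlledNear.of_ball {n : ℕ} {Ω S : Set (Euc n)} (hΩ : IsOpen Ω) {c y z : Euc n} {r : ℝ}
    (hr : Metric.ball c r ⊆ Ω) (hy : y ∈ Metric.ball c r) (hz : z ∈ Metric.ball c r)
    (h : IsControlledNear Ω S y) : IsControlledNear Ω S z := by
  obtain ⟨δ, hδ, hC⟩ := h
  have hev : ∀ᶠ w in 𝓝 z, w ∈ Metric.ball c r ∧ w + (y - z) ∈ Metric.ball c r ∧
      w + (y - z) ∈ Metric.ball y δ := by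
    have hc : Tendsto (fun w => w + (y - z)) (𝓝 z) (𝓝 y) := by
      have : Continuous fun w => w + (y - z) := by fun_prop
      simpa using this.tendsto z
    exact (Metric.isOpen_ball.eventually_mem hz).and
      ((hc.eventually_mem (Metric.isOpen_ball.mem_nhds hy)).and
        (hc.eventually_mem (Metric.ball_mem_nhds y hδ)))
  obtain ⟨ε, hε, hball⟩ := Metric.eventually_nhds_iff_ball.1 hev
  exact ⟨ε, hε, hC.of_translate hΩ measurableSet_ball (y - z) (fun w hw => (hball w hw).2.2)
    fun w hw t ht => hr ((convex_ball c r).add_smul_mem (hball w hw).1 (hball w hw).2.1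
      (Set.Ioo_subset_Icc_self ht))⟩

/-- Inside a ball contained in `Ω`, translations join any two points without leaving `Ω`. So the set
of points with local control is open and relatively closed in `Ω`, and connectedness finishes. -/
theorem isControlledNear_of_mem {n : ℕ} {Ω S : Set (Euc n)} (hΩ : IsOpen Ω)
    (hconn : IsPreconnected Ω) {x₁ : Euc n} (hx₁ : x₁ ∈ Ω) (h₁ : IsControlledNear Ω S x₁)
    {x : Euc n} (hx : x ∈ Ω) : IsControlledNear Ω S x := by
  have hsub : Ω ⊆ {x | x ∈ Ω ∧ IsControlledNear Ω S x} := by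
    refine hconn.subset_of_closure_inter_subset ?_ ⟨x₁, hx₁, hx₁, h₁⟩ ?_
    · refine Metric.isOpen_iff.2 fun y hy => ?_
      obtain ⟨r, hr, hball⟩ := Metric.isOpen_iff.1 hΩ y hy.1
      exact ⟨r, hr, fun z hz => ⟨hball hz, hy.2.of_ball hΩ hball (Metric.mem_ball_self hr) hz⟩⟩
    · rintro z ⟨hz, hzΩ⟩
      obtain ⟨r, hr, hball⟩ := Metric.isOpen_iff.1 hΩ z hzΩ
      obtain ⟨y, hy, hyz⟩ := Metric.mem_closure_iff.1 hz r hr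
      exact ⟨hzΩ, hy.2.of_ball hΩ hball (Metric.mem_ball'.2 hyz) (Metric.mem_ball_self hr)⟩
  exact (hsub hx).2

/-- **Poincaré inequality** for functions whose restriction to an open part `S` of the boundary is
small. -/
theorem isControlled_self {Ω V : Set (Euc 3)} (hΩ : IsOpen Ω) (hconn : IsPreconnected Ω)
    (hbdd : Bornology.IsBounded Ω) (hs : HasSmoothBoundary Ω) (hV : IsOpen V)
    (hne : (frontier Ω ∩ V).Nonempty) : IsControlled Ω (frontier Ω ∩ V) Ω := by
  obtain ⟨x₀, hx₀⟩ := hne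
  obtain ⟨x₁, hx₁, h₁⟩ := exists_isControlled_ball hΩ hs hV hx₀
  set S := frontier Ω ∩ V
  have hnear : ∀ x ∈ Ω, IsControlledNear Ω S x :=
    fun x hx => isControlledNear_of_mem hΩ hconn hx₁ h₁ hx
  -- Up to the boundary, a small inward translation carries a neighbourhood of `x` in `Ω` into a
  -- ball around an interior point, where control is known.
  have hloc : ∀ x ∈ closure Ω, ∃ δ > 0, IsControlled Ω S (Metric.ball x δ ∩ Ω) := by
    intro x hx
    obtain ⟨R, hR, b, hb⟩ := exists_inward_basis hΩ hs hx
    have hcτ : Tendsto (fun τ : ℝ => x + τ • b 0) (𝓝[>] 0) (𝓝 x) := by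
      have : Continuous fun τ : ℝ => x + τ • b 0 := by fun_prop
      simpa using (this.tendsto 0).mono_left nhdsWithin_le_nhds
    obtain ⟨τ, hτR, hτ⟩ := ((hcτ.eventually_mem (Metric.ball_mem_nhds x hR)).and
      self_mem_nhdsWithin).exists
    have hτ : 0 < τ := hτ
    have hin : x + τ • b 0 ∈ Ω := hb 0 x ⟨hx, Metric.mem_ball_self hR⟩ τ hτ hτR
    obtain ⟨δ, hδ, hC⟩ := hnear _ hin
    have hev : ∀ᶠ y in 𝓝 x, y ∈ Metric.ball x R ∧ y + τ • b 0 ∈ Metric.ball x R ∧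
        y + τ • b 0 ∈ Metric.ball (x + τ • b 0) δ := by
      have hc : ContinuousAt (fun y => y + τ • b 0) x := by fun_prop
      exact (Metric.isOpen_ball.eventually_mem (Metric.mem_ball_self hR)).and
        ((hc.eventually_mem (Metric.isOpen_ball.mem_nhds hτR)).and
          (hc.eventually_mem (Metric.ball_mem_nhds _ hδ)))
    obtain ⟨ε, hε, hball⟩ := Metric.eventually_nhds_iff_ball.1 hev
    refine ⟨ε, hε, hC.of_translate hΩ (measurableSet_ball.inter hΩ.measurableSet) (τ • b 0)
      (fun y hy => (hball y hy.1).2.2) fun y hy t ht => ?_⟩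
    have := (convex_ball x R).add_smul_mem (hball y hy.1).1 (hball y hy.1).2.1
      (Set.Ioo_subset_Icc_self ht)
    rw [smul_smul] at this ⊢
    exact hb 0 y ⟨subset_closure hy.2, (hball y hy.1).1⟩ _ (mul_pos ht.1 hτ) this
  have hcpt : IsCompact (closure Ω) := hbdd.isCompact_closure
  have hmain : IsControlled Ω S (closure Ω ∩ Ω) := by
    refine hcpt.induction_on (p := fun s => IsControlled Ω S (s ∩ Ω)) ⟨0, fun φ _ => by simp⟩
      (fun s t hst h => h.mono (Set.inter_subset_inter_left _ hst))
      (fun s t h h' => by rw [Set.union_inter_distrib_right]; exact h.union h') fun x hx => ?_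
    obtain ⟨δ, hδ, h⟩ := hloc x hx
    exact ⟨_, mem_nhdsWithin_of_mem_nhds (Metric.ball_mem_nhds x hδ), h⟩
  exact hmain.mono fun x hx => ⟨subset_closure hx, hx⟩

/-! ### The Sobolev inequality on a smooth domain -/

/-- Follow the ray from `x` in direction `v` until it leaves the ball, where `u` vanishes. As long
as it is in the ball it stays in `Ω`, and outside the ball the gradient is zero, so cutting the
gradient off to `Ω` loses nothing. -/
theorem indicator_enorm_le_lintegral_inward {n : ℕ} {Ω : Set (Euc n)} {x₀ v : Euc n} {R : ℝ}
    (hv0 : v ≠ 0) (hv : IsInward Ω x₀ v R) {u : Euc n → ℝ} (hu : ContDiff ℝ 1 u)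
    (hsupp : tsupport u ⊆ Metric.ball x₀ R) (x : Euc n) :
    Ω.indicator (fun y => ‖u y‖ₑ) x ≤
      ∫⁻ t : ℝ, ‖v‖ₑ * Ω.indicator (fun y => ‖fderiv ℝ u y‖ₑ) (x + t • v) := by
  by_cases hxΩ : x ∈ Ω
  swap
  · simp [hxΩ]
  rw [Set.indicator_of_mem hxΩ]
  by_cases hx : x ∈ Metric.ball x₀ R
  swap
  · have : u x = 0 := by
      by_contra h
      exact hx (hsupp (subset_tsupport u h))
    simp [this]
  obtain ⟨s, hs0, hs⟩ : ∃ s : ℝ, 0 ≤ s ∧ x + s • v ∉ Metric.ball x₀ R := by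
    have hvpos : 0 < ‖v‖ := norm_pos_iff.2 hv0
    refine ⟨(|R| + ‖x - x₀‖) / ‖v‖, by positivity, fun h => ?_⟩
    rw [mem_ball_iff_norm] at h
    have h1 : ‖((|R| + ‖x - x₀‖) / ‖v‖) • v‖ = |R| + ‖x - x₀‖ := by
      rw [norm_smul, Real.norm_eq_abs, abs_of_nonneg (by positivity), div_mul_cancel₀ _ hvpos.ne']
    have h2 := norm_sub_le (x + ((|R| + ‖x - x₀‖) / ‖v‖) • v - x₀) (x - x₀)
    have h3 : x + ((|R| + ‖x - x₀‖) / ‖v‖) • v - x₀ - (x - x₀) =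
      ((|R| + ‖x - x₀‖) / ‖v‖) • v := by abel
    rw [h3, h1] at h2
    linarith [le_abs_self R]
  have hus : u (x + s • v) = 0 := by
    by_contra h
    exact hs (hsupp (subset_tsupport u h))
  have h := enorm_sub_le_lintegral_fderiv hu x v hs0
  rw [hus, zero_sub, enorm_neg] at h
  refine h.trans ((setLIntegral_mono' measurableSet_Ioo fun t ht => ?_).trans
    (lintegral_mono' Measure.restrict_le_self le_rfl))
  by_cases hb : x + t • v ∈ Metric.ball x₀ R
  · rw [Set.indicator_of_mem (hv x ⟨subset_closure hxΩ, hx⟩ t ht.1 hb), mul_comm]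
  · have : fderiv ℝ u (x + t • v) = 0 := by
      by_contra h
      exact hb (hsupp (support_fderiv_subset ℝ h))
    have h0 : ‖fderiv ℝ u (x + t • v)‖ₑ = 0 := by
      rw [← ofReal_norm, this, norm_zero, ENNReal.ofReal_zero]
    exact (mul_eq_zero_of_left h0 _).trans_le zero_le

/-- The Gagliardo-Nirenberg inequality on a domain, for functions supported in a ball in which three
independent directions lead into the domain. -/
theorem exists_lintegral_rpow_le_of_inward {Ω : Set (Euc 3)} (hΩ : IsOpen Ω) {x₀ : Euc 3} {R : ℝ}
    (b : Module.Basis (Fin 3) ℝ (Euc 3)) (hb : ∀ i, IsInward Ω x₀ (b i) R) :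
    ∃ C : NNReal, ∀ u : Euc 3 → ℝ, ContDiff ℝ 1 u → tsupport u ⊆ Metric.ball x₀ R →
      ∫⁻ x in Ω, ‖u x‖ₑ ^ (3 / 2 : ℝ) ≤ C * (∫⁻ x in Ω, ‖fderiv ℝ u x‖ₑ) ^ (3 / 2 : ℝ) := by
  obtain ⟨c, hc⟩ := exists_volume_eq_smul_map b
  set T := b.equivFun.toContinuousLinearEquiv with hT
  have hint : ∀ f : Euc 3 → ℝ≥0∞, Measurable f → ∫⁻ x, f x = c * ∫⁻ y, f (T.symm y) := by
    intro f hf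
    conv_lhs => rw [hc]
    rw [lintegral_smul_measure, lintegral_map hf T.symm.continuous.measurable]
    rfl
  have hc0 : c ≠ 0 := by
    rintro rfl
    simp only [zero_smul] at hc
    exact NeZero.ne (volume : Measure (Euc 3)) hc
  set K : NNReal := ∑ i, ‖b i‖₊ with hK
  -- The outer `c` comes from the change of variables on the left, `c⁻¹` from undoing it on the
  -- right; `K` dominates the length of every basis vector.
  refine ⟨c * (K * c⁻¹) ^ (3 / 2 : ℝ), fun u hu hsupp => ?_⟩
  set g : Euc 3 → ℝ≥0∞ := Ω.indicator fun y => ‖fderiv ℝ u y‖ₑ with hg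
  set h : Euc 3 → ℝ≥0∞ := Ω.indicator fun y => ‖u y‖ₑ with hh
  have hgm : Measurable g := by
    have := hu.continuous_fderiv (by simp)
    exact this.enorm.measurable.indicator hΩ.measurableSet
  have hhm : Measurable h := hu.continuous.enorm.measurable.indicator hΩ.measurableSet
  have hTm : Measurable T.symm := T.symm.continuous.measurable
  have hline : ∀ (y : Fin 3 → ℝ) (i : Fin 3),
      h (T.symm y) ≤ ∫⁻ s, K * g (T.symm (Function.update y i s)) := by
    intro y i
    have hupd : ∀ s, T.symm (Function.update y i s) = T.symm y + (s - y i) • b i := by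
      intro s
      have h1 : Function.update y i s = y + (s - y i) • Pi.single i (1 : ℝ) := by
        ext j
        by_cases hj : j = i
        · subst hj; simp
        · simp [hj]
      have h2 : T.symm (Pi.single i (1 : ℝ)) = b i := by
        rw [ContinuousLinearEquiv.symm_apply_eq]
        ext j
        simp [hT, Pi.single_apply, eq_comm]
      rw [h1, map_add, map_smul, h2]
    simp_rw [hupd]
    rw [lintegral_sub_right_eq_self (fun s => K * g (T.symm y + s • b i)) (y i)]
    refine (indicator_enorm_le_lintegral_inward (b.ne_zero i) (hb i) hu hsupp _).trans ?_
    gcongr with t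
    rw [← enorm_norm, ← ofReal_norm, norm_norm, ← coe_nnnorm, ENNReal.ofReal_coe_nnreal,
      ENNReal.coe_le_coe, hK]
    exact Finset.single_le_sum (f := fun i => ‖b i‖₊) (fun _ _ => zero_le) (Finset.mem_univ i)
  -- Loomis–Whitney type inequality: `h^(3/2)` is the product of three factors `h^(1/2)`, each
  -- bounded by the line integral in one coordinate direction.
  have hgrid : ∫⁻ y, h (T.symm y) ^ (3 / 2 : ℝ) ≤ (∫⁻ y, K * g (T.symm y)) ^ (3 / 2 : ℝ) := by
    have hp : Real.HolderConjugate (Fintype.card (Fin 3)) (3 / 2) := by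
      rw [Real.holderConjugate_iff]
      norm_num
    refine le_trans ?_ (lintegral_prod_lintegral_pow_le (fun _ : Fin 3 => (volume : Measure ℝ)) hp
      (f := fun y => K * g (T.symm y)) ((hgm.comp hTm).const_mul _))
    rw [← volume_pi]
    refine lintegral_mono fun y => ?_
    calc h (T.symm y) ^ (3 / 2 : ℝ) = ∏ _i : Fin 3, h (T.symm y) ^ (1 / 2 : ℝ) := by
          rw [Finset.prod_const, ← ENNReal.rpow_mul_natCast]
          norm_num
      _ ≤ _ := by
          refine Finset.prod_le_prod' fun i _ => ?_
          norm_num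
          gcongr
          exact hline y i
  have hL : ∫⁻ x in Ω, ‖u x‖ₑ ^ (3 / 2 : ℝ) = ∫⁻ x, h x ^ (3 / 2 : ℝ) := by
    rw [← lintegral_indicator hΩ.measurableSet]
    congr with x
    by_cases hx : x ∈ Ω <;> simp [hh, hx]
  rw [hL, hint _ (hhm.pow_const _), ← lintegral_indicator hΩ.measurableSet, hint _ hgm]
  calc c * ∫⁻ y, h (T.symm y) ^ (3 / 2 : ℝ)
      ≤ c * (∫⁻ y, K * g (T.symm y)) ^ (3 / 2 : ℝ) := by gcongr
    _ = c * ((K * (c : ℝ≥0∞)⁻¹) * (c * ∫⁻ y, g (T.symm y))) ^ (3 / 2 : ℝ) := by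
        rw [lintegral_const_mul _ (show Measurable fun y => g (T.symm y) from hgm.comp hTm),
          mul_assoc, ← mul_assoc _ (c : ℝ≥0∞),
          ENNReal.inv_mul_cancel (by simpa using hc0) ENNReal.coe_ne_top, one_mul]
    _ = _ := by
        rw [ENNReal.mul_rpow_of_nonneg _ _ (by norm_num : (0 : ℝ) ≤ 3 / 2), ENNReal.coe_mul,
          ENNReal.coe_rpow_of_nonneg _ (by norm_num : (0 : ℝ) ≤ 3 / 2), ENNReal.coe_mul,
          ENNReal.coe_inv hc0, mul_assoc]

/-- Apply the `L^(3/2)` inequality to `χ φ⁴`: its `3/2` power is `|φ|⁶` where the cutoff is 1, and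
its gradient is of order `|φ|³ (|∇φ| + |φ|)`. -/
theorem exists_local_sobolev {Ω : Set (Euc 3)} (hΩ : IsOpen Ω) (hs : HasSmoothBoundary Ω)
    {x₀ : Euc 3} (hx₀ : x₀ ∈ closure Ω) :
    ∃ r > 0, ∃ C : NNReal, ∀ φ : Euc 3 → ℝ, ContDiff ℝ 1 φ →
      ∫⁻ x in Metric.ball x₀ r ∩ Ω, ‖φ x‖ₑ ^ 6 ≤
        C * (∫⁻ x in Ω, ‖φ x‖ₑ ^ 3 * (‖fderiv ℝ φ x‖ₑ + ‖φ x‖ₑ)) ^ (3 / 2 : ℝ) := by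
  obtain ⟨R, hR, b, hb⟩ := exists_inward_basis hΩ hs hx₀
  obtain ⟨C, hC⟩ := exists_lintegral_rpow_le_of_inward hΩ b hb
  let χ : ContDiffBump x₀ := ⟨R / 4, R / 2, by positivity, by linarith⟩
  have hχ : ContDiff ℝ 1 χ := χ.contDiff
  obtain ⟨M, hM⟩ := (hχ.continuous_fderiv (by simp)).bounded_above_of_compact_support
    (χ.hasCompactSupport.fderiv (𝕜 := ℝ))
  have hM0 : 0 ≤ M := (norm_nonneg _).trans (hM x₀)
  refine ⟨R / 4, by positivity, C * (4 + M.toNNReal) ^ (3 / 2 : ℝ), fun φ hφ => ?_⟩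
  have hu : ContDiff ℝ 1 fun x => χ x * φ x ^ 4 := hχ.mul (hφ.pow 4)
  have hsupp : tsupport (fun x => χ x * φ x ^ 4) ⊆ Metric.ball x₀ R := by
    refine (tsupport_mul_subset_left).trans ?_
    rw [χ.tsupport_eq]
    exact Metric.closedBall_subset_ball (by change R / 2 < R; linarith)
  have hder : ∀ x, ‖fderiv ℝ (fun x => χ x * φ x ^ 4) x‖ₑ ≤
      (4 + M.toNNReal : NNReal) * (‖φ x‖ₑ ^ 3 * (‖fderiv ℝ φ x‖ₑ + ‖φ x‖ₑ)) := by
    intro x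
    have h1 : HasFDerivAt (fun x => χ x * φ x ^ 4)
        (χ x • ((4 * φ x ^ 3) • fderiv ℝ φ x) + φ x ^ 4 • fderiv ℝ χ x) x := by
      have h2 := (hφ.differentiable (by simp) x).hasFDerivAt.pow 4
      have h3 := (hχ.differentiable (by simp) x).hasFDerivAt.mul h2
      convert! h3 using 2
      simp
    have hreal : ‖fderiv ℝ (fun x => χ x * φ x ^ 4) x‖ ≤
        (4 + M) * (‖φ x‖ ^ 3 * (‖fderiv ℝ φ x‖ + ‖φ x‖)) := by
      rw [h1.fderiv]
      calc _ ≤ ‖χ x‖ * (4 * ‖φ x‖ ^ 3 * ‖fderiv ℝ φ x‖) + ‖φ x‖ ^ 4 * ‖fderiv ℝ χ x‖ := by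
            refine (norm_add_le _ _).trans (le_of_eq ?_)
            rw [norm_smul, norm_smul, norm_smul, norm_mul, norm_pow, norm_pow]
            norm_num
        _ ≤ 1 * (4 * ‖φ x‖ ^ 3 * ‖fderiv ℝ φ x‖) + ‖φ x‖ ^ 4 * M := by
            gcongr
            · rw [Real.norm_eq_abs, abs_of_nonneg χ.nonneg]
              exact χ.le_one
            · exact hM x
        _ ≤ _ := by
            have h4 : 0 ≤ M * (‖φ x‖ ^ 3 * ‖fderiv ℝ φ x‖) := by positivity
            have h5 : 0 ≤ ‖φ x‖ ^ 4 := by positivity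
            nlinarith
    have := ENNReal.ofReal_le_ofReal hreal
    rw [ofReal_norm, ENNReal.ofReal_mul (by positivity), ENNReal.ofReal_mul (by positivity),
      ENNReal.ofReal_pow (norm_nonneg _), ENNReal.ofReal_add (by positivity) (by positivity),
      ENNReal.ofReal_add (by positivity) (by positivity), ofReal_norm, ofReal_norm] at this
    simpa [ENNReal.ofReal] using this
  have hmeas : Measurable fun x => ‖φ x‖ₑ ^ 3 * (‖fderiv ℝ φ x‖ₑ + ‖φ x‖ₑ) := by
    have h1 := (hφ.continuous_fderiv (by simp)).enorm.measurable
    have h2 := hφ.continuous.enorm.measurable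
    fun_prop
  calc ∫⁻ x in Metric.ball x₀ (R / 4) ∩ Ω, ‖φ x‖ₑ ^ 6
      = ∫⁻ x in Metric.ball x₀ (R / 4) ∩ Ω, ‖χ x * φ x ^ 4‖ₑ ^ (3 / 2 : ℝ) := by
        refine setLIntegral_congr_fun (measurableSet_ball.inter hΩ.measurableSet) fun x hx => ?_
        have : χ x = 1 := χ.one_of_mem_closedBall (Metric.ball_subset_closedBall hx.1)
        simp only [this, one_mul, enorm_pow]
        rw [← ENNReal.rpow_natCast, ← ENNReal.rpow_natCast, ← ENNReal.rpow_mul]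
        norm_num
    _ ≤ ∫⁻ x in Ω, ‖χ x * φ x ^ 4‖ₑ ^ (3 / 2 : ℝ) := lintegral_mono_set Set.inter_subset_right
    _ ≤ C * (∫⁻ x in Ω, ‖fderiv ℝ (fun x => χ x * φ x ^ 4) x‖ₑ) ^ (3 / 2 : ℝ) := hC _ hu hsupp
    _ ≤ C * (∫⁻ x in Ω, (4 + M.toNNReal : NNReal) *
          (‖φ x‖ₑ ^ 3 * (‖fderiv ℝ φ x‖ₑ + ‖φ x‖ₑ))) ^ (3 / 2 : ℝ) := by
        gcongr with x
        exact hder x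
    _ = _ := by
        rw [lintegral_const_mul _ hmeas, ENNReal.mul_rpow_of_nonneg _ _ (by norm_num), ENNReal.coe_mul,
          ENNReal.coe_rpow_of_nonneg _ (by norm_num), mul_assoc]

/-- **Sobolev inequality** on a smooth bounded domain in `ℝ³`. -/
theorem exists_sobolev {Ω : Set (Euc 3)} (hΩ : IsOpen Ω) (hbdd : Bornology.IsBounded Ω)
    (hs : HasSmoothBoundary Ω) :
    ∃ C : NNReal, ∀ φ : Euc 3 → ℝ, ContDiff ℝ 1 φ →
      ∫⁻ x in Ω, ‖φ x‖ₑ ^ 6 ≤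
        C * ((∫⁻ x in Ω, ‖fderiv ℝ φ x‖ₑ ^ 2) + ∫⁻ x in Ω, ‖φ x‖ₑ ^ 2) ^ 3 := by
  have hcpt : IsCompact (closure Ω) := hbdd.isCompact_closure
  obtain ⟨C, hC⟩ : ∃ C : NNReal, ∀ φ : Euc 3 → ℝ, ContDiff ℝ 1 φ →
      ∫⁻ x in closure Ω ∩ Ω, ‖φ x‖ₑ ^ 6 ≤
        C * (∫⁻ x in Ω, ‖φ x‖ₑ ^ 3 * (‖fderiv ℝ φ x‖ₑ + ‖φ x‖ₑ)) ^ (3 / 2 : ℝ) := by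
    refine hcpt.induction_on (p := fun s => ∃ C : NNReal, ∀ φ : Euc 3 → ℝ, ContDiff ℝ 1 φ →
      ∫⁻ x in s ∩ Ω, ‖φ x‖ₑ ^ 6 ≤
        C * (∫⁻ x in Ω, ‖φ x‖ₑ ^ 3 * (‖fderiv ℝ φ x‖ₑ + ‖φ x‖ₑ)) ^ (3 / 2 : ℝ))
      ⟨0, fun φ _ => by simp⟩ ?_ ?_ fun x hx => ?_
    · rintro s t hst ⟨C, hC⟩
      exact ⟨C, fun φ hφ =>
        (lintegral_mono_set (Set.inter_subset_inter_left _ hst)).trans (hC φ hφ)⟩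
    · rintro s t ⟨C, hC⟩ ⟨C', hC'⟩
      refine ⟨C + C', fun φ hφ => ?_⟩
      rw [Set.union_inter_distrib_right, ENNReal.coe_add, add_mul]
      exact (lintegral_union_le _ _ _).trans (add_le_add (hC φ hφ) (hC' φ hφ))
    · obtain ⟨δ, hδ, h⟩ := exists_local_sobolev hΩ hs hx
      exact ⟨_, mem_nhdsWithin_of_mem_nhds (Metric.ball_mem_nhds x hδ), h⟩
  rw [Set.inter_eq_right.2 subset_closure] at hC
  refine ⟨C ^ 4 * 8, fun φ hφ => ?_⟩
  have hfm := (hφ.continuous_fderiv (by simp)).enorm.measurable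
  have hφm := hφ.continuous.enorm.measurable
  set A := ∫⁻ x in Ω, ‖φ x‖ₑ ^ 6 with hA
  set Z := ∫⁻ x in Ω, ‖φ x‖ₑ ^ 3 * (‖fderiv ℝ φ x‖ₑ + ‖φ x‖ₑ)
  set G := ∫⁻ x in Ω, ‖fderiv ℝ φ x‖ₑ ^ 2
  set Q := ∫⁻ x in Ω, ‖φ x‖ₑ ^ 2
  -- Finiteness, from continuity on the compact closure, permits cancelling `A ^ 3` at the end.
  have hAtop : A ≠ ⊤ := by
    have h1 : IntegrableOn (fun x => φ x ^ 6) Ω :=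
      ((hφ.continuous.pow 6).continuousOn.integrableOn_compact hcpt).mono_set subset_closure
    have := h1.2.ne
    simpa [HasFiniteIntegral, hA] using this
  have hZ : Z ^ 2 ≤ A * (2 * (G + Q)) := by
    refine (sq_lintegral_mul_le _ (hφm.pow_const 3).aemeasurable (hfm.add hφm).aemeasurable).trans ?_
    refine mul_le_mul' (le_of_eq ?_) ?_
    · simp_rw [← pow_mul]
      rfl
    · calc _ ≤ ∫⁻ x in Ω, 2 * (‖fderiv ℝ φ x‖ₑ ^ 2 + ‖φ x‖ₑ ^ 2) :=
            lintegral_mono fun x => ENNReal.add_sq_le_two_mul _ _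
        _ = _ := by
            rw [lintegral_const_mul _ (by fun_prop), lintegral_add_left (by fun_prop)]
  -- Raise `A ≤ C Z^(3/2)` to the fourth power and insert the Cauchy–Schwarz bound for `Z²`; the 8
  -- is the cube of the factor 2 there.
  have hA4 : A * A ^ 3 ≤ (C ^ 4 * 8 : NNReal) * (G + Q) ^ 3 * A ^ 3 := by
    calc A * A ^ 3 = A ^ 4 := by ring
      _ ≤ (C * Z ^ (3 / 2 : ℝ)) ^ 4 := by gcongr; exact hC φ hφ
      _ = C ^ 4 * (Z ^ 2) ^ 3 := by
          rw [mul_pow, ← ENNReal.rpow_mul_natCast, ← pow_mul, ← ENNReal.rpow_natCast Z (2 * 3)]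
          norm_num
      _ ≤ C ^ 4 * (A * (2 * (G + Q))) ^ 3 := by gcongr
      _ = _ := by
          push_cast
          ring
  by_cases hA0 : A = 0
  · simp [hA0]
  · exact (ENNReal.mul_le_mul_iff_left (pow_ne_zero 3 hA0) (ENNReal.pow_ne_top hAtop)).1 hA4

/-! ### Norms and passage to `L²` limits -/

theorem eLpNorm_natCast_pow {α : Type*} [MeasurableSpace α] {E : Type*} [NormedAddCommGroup E]
    (f : α → E) (μ : Measure α) {k : ℕ} (hk : k ≠ 0) :
    eLpNorm f k μ ^ k = ∫⁻ x, ‖f x‖ₑ ^ k ∂μ := by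
  rw [eLpNorm_eq_lintegral_rpow_enorm_toReal (by simpa using hk) (by simp)]
  simp only [ENNReal.toReal_natCast, ENNReal.rpow_natCast]
  rw [← ENNReal.rpow_mul_natCast, one_div, inv_mul_cancel₀ (by exact_mod_cast hk), ENNReal.rpow_one]

theorem eLpNorm_two_sq {α : Type*} [MeasurableSpace α] {E : Type*} [NormedAddCommGroup E]
    (f : α → E) (μ : Measure α) : eLpNorm f 2 μ ^ 2 = ∫⁻ x, ‖f x‖ₑ ^ 2 ∂μ := by
  simpa using eLpNorm_natCast_pow f μ two_ne_zero

theorem eLpNorm_six_pow {α : Type*} [MeasurableSpace α] {E : Type*} [NormedAddCommGroup E]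
    (f : α → E) (μ : Measure α) : eLpNorm f 6 μ ^ 6 = ∫⁻ x, ‖f x‖ₑ ^ 6 ∂μ := by
  simpa using eLpNorm_natCast_pow f μ (k := 6) (by norm_num)

theorem eLpNorm_two_eq_sqrt {α : Type*} [MeasurableSpace α] {f : α → ℝ} {μ : Measure α}
    (hf : MemLp f 2 μ) : eLpNorm f 2 μ = ENNReal.ofReal √(∫ x, f x ^ 2 ∂μ) := by
  rw [hf.eLpNorm_eq_integral_rpow_norm (by simp) (by simp)]
  simp [Real.sqrt_eq_rpow]

theorem ENNReal.exists_const_of_pow_le {x y : ℝ≥0∞} {C : NNReal} {k : ℕ} (hk : k ≠ 0)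
    (h : x ^ k ≤ C * y ^ k) : x ≤ (C + 1 : NNReal) * y := by
  refine (ENNReal.pow_le_pow_left_iff hk).1 (h.trans ?_)
  rw [mul_pow]
  gcongr
  calc (C : ℝ≥0∞) ≤ (C + 1 : NNReal) := by exact_mod_cast le_self_add
    _ ≤ _ := le_self_pow (by exact_mod_cast le_add_self) hk

/-- Fatou's lemma along an almost everywhere convergent subsequence. The exponent `q` is arbitrary,
so `L⁶` bounds survive mere `L²` convergence. -/
theorem TendstoL2.eLpNorm_le {α : Type*} [MeasurableSpace α] {μ : Measure α} {f : ℕ → α → ℝ}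
    {g : α → ℝ} (h : TendstoL2 μ f g) (hf : ∀ k, AEStronglyMeasurable (f k) μ)
    (hg : AEStronglyMeasurable g μ) {q : ℝ≥0∞} {b : ℕ → ℝ≥0∞} {β : ℝ≥0∞}
    (hb : ∀ k, eLpNorm (f k) q μ ≤ b k) (hβ : Tendsto b atTop (𝓝 β)) : eLpNorm g q μ ≤ β := by
  obtain ⟨ns, hns, hae⟩ :=
    (tendstoInMeasure_of_tendsto_eLpNorm two_ne_zero hf hg h).exists_seq_tendsto_ae
  refine (Lp.eLpNorm_lim_le_liminf_eLpNorm (fun n => hf (ns n)) g hae).trans ?_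
  rw [← (hβ.comp hns.tendsto_atTop).liminf_eq]
  exact liminf_le_liminf (Eventually.of_forall fun n => hb (ns n))

theorem TendstoL2.tendsto_eLpNorm {α : Type*} [MeasurableSpace α] {μ : Measure α} {f : ℕ → α → ℝ}
    {g : α → ℝ} (h : TendstoL2 μ f g) (hf : ∀ k, AEStronglyMeasurable (f k) μ)
    (hg : AEStronglyMeasurable g μ) :
    Tendsto (fun k => eLpNorm (f k) 2 μ) atTop (𝓝 (eLpNorm g 2 μ)) := by
  have h : Tendsto (fun k => eLpNorm (f k - g) 2 μ) atTop (𝓝 0) := h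
  have hlow : Tendsto (fun k => eLpNorm g 2 μ - eLpNorm (f k - g) 2 μ) atTop
      (𝓝 (eLpNorm g 2 μ)) := by
    simpa using ENNReal.Tendsto.sub (tendsto_const_nhds (x := eLpNorm g 2 μ)) h (Or.inr (by simp))
  have hup : Tendsto (fun k => eLpNorm (f k - g) 2 μ + eLpNorm g 2 μ) atTop
      (𝓝 (eLpNorm g 2 μ)) := by
    simpa using h.add (tendsto_const_nhds (x := eLpNorm g 2 μ))
  refine tendsto_of_tendsto_of_tendsto_of_le_of_le hlow hup (fun k => ?_) fun k => ?_
  · refine tsub_le_iff_right.2 ?_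
    have := eLpNorm_sub_le (hf k) ((hf k).sub hg) (p := 2) (by norm_num)
    rwa [sub_sub_cancel] at this
  · have := eLpNorm_add_le ((hf k).sub hg) hg (p := 2) (by norm_num)
    rwa [sub_add_cancel] at this

theorem TendstoL2.sum {α ι : Type*} [MeasurableSpace α] [Fintype ι] {μ : Measure α}
    {f : ι → ℕ → α → ℝ} {g : ι → α → ℝ} (h : ∀ i, TendstoL2 μ (f i) (g i))
    (hf : ∀ i k, AEStronglyMeasurable (f i k) μ) (hg : ∀ i, AEStronglyMeasurable (g i) μ) :
    TendstoL2 μ (fun k x => ∑ i, f i k x) fun x => ∑ i, g i x := by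
  have h0 : Tendsto (fun k => ∑ i, eLpNorm (fun x => f i k x - g i x) 2 μ) atTop (𝓝 0) := by
    simpa using tendsto_finsetSum Finset.univ fun i _ => h i
  refine tendsto_of_tendsto_of_tendsto_of_le_of_le tendsto_const_nhds h0
    (fun _ => zero_le) fun k => ?_
  have := eLpNorm_sum_le (f := fun i x => f i k x - g i x) (s := Finset.univ) (μ := μ) (p := 2)
    (fun i _ => (hf i k).sub (hg i)) (by norm_num)
  convert! this using 2
  ext x
  simp [Finset.sum_sub_distrib]

theorem norm_le_sum_single {n : ℕ} (ℓ : Euc n →L[ℝ] ℝ) :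
    ‖ℓ‖ ≤ ∑ i, |ℓ (EuclideanSpace.single i 1)| := by
  refine ℓ.opNorm_le_bound (Finset.sum_nonneg fun _ _ => abs_nonneg _) fun v => ?_
  have hv : v = ∑ i, v i • EuclideanSpace.single i (1 : ℝ) := by
    have := (EuclideanSpace.basisFun (Fin n) ℝ).sum_repr v
    simpa using this.symm
  calc ‖ℓ v‖ = ‖∑ i, v i * ℓ (EuclideanSpace.single i 1)‖ := by
        conv_lhs => rw [hv, map_sum]
        simp
    _ ≤ ∑ i, ‖v i * ℓ (EuclideanSpace.single i 1)‖ := norm_sum_le _ _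
    _ ≤ ∑ i, |ℓ (EuclideanSpace.single i 1)| * ‖v‖ := by
        refine Finset.sum_le_sum fun i _ => ?_
        rw [norm_mul, mul_comm]
        exact mul_le_mul_of_nonneg_left (PiLp.norm_apply_le v i) (norm_nonneg _)
    _ = _ := by rw [Finset.sum_mul]

theorem enorm_fderiv_sq_le {n : ℕ} (φ : Euc n → ℝ) (x : Euc n) :
    ‖fderiv ℝ φ x‖ₑ ^ 2 ≤ n * ∑ i, ‖partialDeriv i φ x‖ₑ ^ 2 := by
  have h1 : ‖fderiv ℝ φ x‖ ^ 2 ≤ n * ∑ i, |partialDeriv i φ x| ^ 2 := by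
    calc _ ≤ (∑ i, |partialDeriv i φ x|) ^ 2 := by
          gcongr
          exact norm_le_sum_single _
      _ ≤ _ := by
          simpa using sq_sum_le_card_mul_sum_sq (s := Finset.univ)
            (f := fun i => |partialDeriv i φ x|)
  have := ENNReal.ofReal_le_ofReal h1
  rw [ENNReal.ofReal_pow (norm_nonneg _), ofReal_norm, ENNReal.ofReal_mul (by positivity),
    ENNReal.ofReal_sum_of_nonneg (fun _ _ => by positivity), ENNReal.ofReal_natCast] at this
  refine this.trans (le_of_eq ?_)
  congr 1
  refine Finset.sum_congr rfl fun i _ => ?_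
  rw [ENNReal.ofReal_pow (abs_nonneg _), ← Real.enorm_eq_ofReal_abs]

theorem ContDiff.partialDeriv {n : ℕ} {φ : Euc n → ℝ} (hφ : ContDiff ℝ ∞ φ) (i : Fin n) :
    ContDiff ℝ ∞ (partialDeriv i φ) :=
  (hφ.fderiv_right (m := ∞) (by simp)).clm_apply contDiff_const

theorem lintegral_fderiv_sq_le {n : ℕ} {φ : Euc n → ℝ} (hφ : ContDiff ℝ ∞ φ) (U : Set (Euc n)) :
    ∫⁻ x in U, ‖fderiv ℝ φ x‖ₑ ^ 2 ≤
      n * ∑ i, eLpNorm (partialDeriv i φ) 2 (volume.restrict U) ^ 2 := by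
  have hm : ∀ i, Measurable fun x => ‖partialDeriv i φ x‖ₑ ^ 2 := fun i =>
    (hφ.partialDeriv i).continuous.enorm.measurable.pow_const 2
  calc _ ≤ ∫⁻ x in U, n * ∑ i, ‖partialDeriv i φ x‖ₑ ^ 2 :=
        lintegral_mono fun x => enorm_fderiv_sq_le φ x
    _ = _ := by
        rw [lintegral_const_mul _ (Finset.measurable_sum _ fun i _ => hm i),
          lintegral_finsetSum _ fun i _ => hm i]
        simp_rw [eLpNorm_two_sq]

/-! ### The embeddings into `L⁶` -/

theorem isWeakPartial_weakPartial {n : ℕ} {U : Set (Euc n)} {i : Fin n} {u : Euc n → ℝ}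
    (h : ∃ g, IsWeakPartial U i u g) : IsWeakPartial U i u (weakPartial U i u) := by
  rw [weakPartial, dif_pos h]
  exact h.choose_spec

theorem MemH1.memLp_weakPartial {n : ℕ} {U : Set (Euc n)} {u : Euc n → ℝ} (h : MemH1 U u)
    (i : Fin n) : MemLp (weakPartial U i u) 2 (volume.restrict U) :=
  (isWeakPartial_weakPartial (h.2 i)).2.1

/-- The embedding `H¹_S(Ω) → L⁶(Ω)`, with the norm `‖∇u‖₂` on the left. -/
theorem exists_eLpNorm_six_le {Ω V : Set (Euc 3)} (hΩ : IsOpen Ω) (hconn : IsPreconnected Ω)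
    (hbdd : Bornology.IsBounded Ω) (hs : HasSmoothBoundary Ω) (hV : IsOpen V)
    (hne : (frontier Ω ∩ V).Nonempty) :
    ∃ C : NNReal, ∀ u : Euc 3 → ℝ, HasTrace Ω (frontier Ω ∩ V) u 0 →
      eLpNorm u 6 (volume.restrict Ω) ≤
        C * ∑ i, eLpNorm (weakPartial Ω i u) 2 (volume.restrict Ω) := by
  obtain ⟨C₁, hC₁⟩ := exists_sobolev hΩ hbdd hs
  obtain ⟨C₂, hC₂⟩ := isControlled_self hΩ hconn hbdd hs hV hne
  set S := frontier Ω ∩ V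
  set μS := (Measure.hausdorffMeasure 2 : Measure (Euc 3)).restrict S
  -- The 4 is 3 + 1: the dimensional factor between gradient and partial derivatives, plus the
  -- boundary term. The final `+ 1` avoids taking a sixth root of the constant.
  refine ⟨C₁ * ((1 + C₂) * 4) ^ 3 + 1, fun u ⟨huH, φ, hφ, hφu, hφ', hφS⟩ => ?_⟩
  have hm : ∀ ψ : Euc 3 → ℝ, ContDiff ℝ ∞ ψ → ∀ μ : Measure (Euc 3), AEStronglyMeasurable ψ μ :=
    fun ψ hψ μ => hψ.continuous.aestronglyMeasurable
  have hbound : ∀ k, eLpNorm (φ k) 6 (volume.restrict Ω) ≤ (C₁ * ((1 + C₂) * 4) ^ 3 + 1 : NNReal) *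
      (∑ i, eLpNorm (partialDeriv i (φ k)) 2 (volume.restrict Ω) + eLpNorm (φ k) 2 μS) := by
    intro k
    refine ENNReal.exists_const_of_pow_le (by norm_num : 6 ≠ 0) ?_
    have h1 : ContDiff ℝ 1 (φ k) := (hφ k).of_le (by simp)
    rw [eLpNorm_six_pow]
    refine (hC₁ _ h1).trans ?_
    set P := ∑ i, eLpNorm (partialDeriv i (φ k)) 2 (volume.restrict Ω)
    set t := eLpNorm (φ k) 2 μS
    have hG : ∫⁻ x in Ω, ‖fderiv ℝ (φ k) x‖ₑ ^ 2 ≤ 3 * (P + t) ^ 2 := by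
      refine (lintegral_fderiv_sq_le (hφ k) Ω).trans ?_
      push_cast
      gcongr
      exact (Finset.sum_sq_le_sq_sum_of_nonneg fun _ _ => zero_le).trans (by gcongr; exact le_self_add)
    have hT : ∫⁻ x in S, ‖φ k x‖ₑ ^ 2 ∂Measure.hausdorffMeasure 2 ≤ 1 * (P + t) ^ 2 := by
      rw [← eLpNorm_two_sq, one_mul]
      gcongr
      exact le_add_self
    calc _ ≤ C₁ * (3 * (P + t) ^ 2 + C₂ * (3 * (P + t) ^ 2 + 1 * (P + t) ^ 2)) ^ 3 := by
          gcongr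
          exact (hC₂ _ h1).trans (by gcongr)
      _ ≤ C₁ * (4 * (P + t) ^ 2 + C₂ * (3 * (P + t) ^ 2 + 1 * (P + t) ^ 2)) ^ 3 := by
          gcongr
          norm_num
      _ = _ := by
          push_cast
          ring
  -- The boundary term disappears in the limit because the trace is zero.
  have hlim : Tendsto (fun k => (C₁ * ((1 + C₂) * 4) ^ 3 + 1 : NNReal) *
      (∑ i, eLpNorm (partialDeriv i (φ k)) 2 (volume.restrict Ω) + eLpNorm (φ k) 2 μS)) atTop
      (𝓝 ((C₁ * ((1 + C₂) * 4) ^ 3 + 1 : NNReal) *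
        (∑ i, eLpNorm (weakPartial Ω i u) 2 (volume.restrict Ω) + 0))) := by
    refine ENNReal.Tendsto.const_mul ((tendsto_finsetSum _ fun i _ => ?_).add ?_)
      (Or.inr ENNReal.coe_ne_top)
    · exact (hφ' i).tendsto_eLpNorm (fun k => hm _ ((hφ k).partialDeriv i) _)
        (huH.memLp_weakPartial i).1
    · simpa [TendstoL2] using hφS
  rw [add_zero] at hlim
  exact hφu.eLpNorm_le (fun k => hm _ (hφ k) _) huH.1.1 hbound hlim

theorem IsTestFunction.partialDeriv {n : ℕ} {U : Set (Euc n)} {φ : Euc n → ℝ}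
    (hφ : IsTestFunction U φ) (i : Fin n) : IsTestFunction U (partialDeriv i φ) := by
  have hsub : tsupport (_root_.partialDeriv i φ) ⊆ tsupport φ :=
    closure_minimal ((fun x hx => support_fderiv_subset ℝ (fun h => hx (by
      simp [_root_.partialDeriv, h])))) (isClosed_tsupport _)
  exact ⟨hφ.1.partialDeriv i, hφ.2.1.of_isClosed_subset (isClosed_tsupport _) hsub,
    hsub.trans hφ.2.2⟩

theorem IsTestFunction.integrable_mul {n : ℕ} {U : Set (Euc n)} {φ ψ : Euc n → ℝ}
    (hφ : IsTestFunction U φ) (hψ : ContDiff ℝ ∞ ψ) : Integrable fun x => φ x * ψ x :=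
  (hφ.1.continuous.mul hψ.continuous).integrable_of_hasCompactSupport hφ.2.1.mul_right

theorem IsTestFunction.integral_mul_partialDeriv {n : ℕ} {U : Set (Euc n)} {φ ψ : Euc n → ℝ}
    (hφ : IsTestFunction U φ) (hψ : ContDiff ℝ ∞ ψ) (i : Fin n) :
    ∫ x, φ x * _root_.partialDeriv i ψ x = - ∫ x, _root_.partialDeriv i φ x * ψ x :=
  integral_mul_fderiv_eq_neg_fderiv_mul_of_integrable ((hφ.partialDeriv i).integrable_mul hψ)
    (hφ.integrable_mul (hψ.partialDeriv i)) (hφ.integrable_mul hψ)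
    (fun x _ => hφ.1.differentiable (by simp) x) fun x _ => hψ.differentiable (by simp) x

/-- Integration by parts gives `∫ |∇φ|² = -∫ φ Δφ`; then Cauchy–Schwarz. -/
theorem IsTestFunction.sum_eLpNorm_partialDeriv_sq_le {n : ℕ} {U : Set (Euc n)} {φ : Euc n → ℝ}
    (hφ : IsTestFunction U φ) :
    ∑ i, eLpNorm (_root_.partialDeriv i φ) 2 (volume.restrict U) ^ 2 ≤
      eLpNorm φ 2 (volume.restrict U) *
        eLpNorm (fun x => ∑ i, _root_.partialDeriv i (_root_.partialDeriv i φ) x) 2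
          (volume.restrict U) := by
  set Δφ : Euc n → ℝ := fun x => ∑ i, _root_.partialDeriv i (_root_.partialDeriv i φ) x with hΔ
  have hΔc : Continuous Δφ :=
    continuous_finsetSum _ fun i _ => ((hφ.1.partialDeriv i).partialDeriv i).continuous
  have h1 : ∑ i, ∫ x, _root_.partialDeriv i φ x ^ 2 = - ∫ x, φ x * Δφ x := by
    simp_rw [hΔ, Finset.mul_sum]
    rw [integral_finsetSum _ fun i _ => hφ.integrable_mul ((hφ.1.partialDeriv i).partialDeriv i),
      ← Finset.sum_neg_distrib]
    refine Finset.sum_congr rfl fun i _ => ?_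
    rw [hφ.integral_mul_partialDeriv (hφ.1.partialDeriv i), neg_neg]
    simp_rw [sq]
  have hsupp : ∀ x, x ∉ U → φ x = 0 := fun x hx => by
    by_contra h
    exact hx (hφ.2.2 (subset_tsupport φ h))
  calc ∑ i, eLpNorm (_root_.partialDeriv i φ) 2 (volume.restrict U) ^ 2
      ≤ ∑ i, ENNReal.ofReal (∫ x, _root_.partialDeriv i φ x ^ 2) := by
        refine Finset.sum_le_sum fun i _ => ?_
        have hint : Integrable fun x => _root_.partialDeriv i φ x ^ 2 := by
          simpa [sq] using (hφ.partialDeriv i).integrable_mul (hφ.1.partialDeriv i)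
        rw [eLpNorm_two_sq, ofReal_integral_eq_lintegral_ofReal hint
          (Eventually.of_forall fun x => sq_nonneg _)]
        refine lintegral_mono' Measure.restrict_le_self fun x => le_of_eq ?_
        rw [← sq_abs, ENNReal.ofReal_pow (abs_nonneg _), Real.enorm_eq_ofReal_abs]
    _ = ENNReal.ofReal (- ∫ x, φ x * Δφ x) := by
        rw [← h1, ENNReal.ofReal_sum_of_nonneg fun i _ => integral_nonneg fun x => sq_nonneg _]
    _ ≤ ‖∫ x, φ x * Δφ x‖ₑ := by
        rw [Real.enorm_eq_ofReal_abs]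
        exact ENNReal.ofReal_le_ofReal (neg_le_abs _)
    _ ≤ ∫⁻ x, ‖φ x * Δφ x‖ₑ := enorm_integral_le_lintegral_enorm _
    _ = ∫⁻ x in U, ‖φ x * Δφ x‖ₑ := by
        rw [setLIntegral_eq_of_support_subset]
        intro x hx
        by_contra h
        exact hx (by simp [hsupp x h])
    _ = ∫⁻ x in U, ‖φ x‖ₑ * ‖Δφ x‖ₑ := by simp_rw [enorm_mul]
    _ ≤ _ := by
        refine (ENNReal.pow_le_pow_left_iff two_ne_zero).1 ?_
        rw [mul_pow, eLpNorm_two_sq, eLpNorm_two_sq]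
        exact sq_lintegral_mul_le _ hφ.1.continuous.enorm.measurable.aemeasurable
          hΔc.enorm.measurable.aemeasurable

/-- In the plane, 6 is the Sobolev exponent of `3/2`, since `2/3 - 1/2 = 1/6`. Hölder on the bounded
set then raises `3/2` to 2. -/
theorem exists_eLpNorm_six_le_fderiv {D : Set (Euc 2)} (hbdd : Bornology.IsBounded D) :
    ∃ C : NNReal, ∀ φ : Euc 2 → ℝ, IsTestFunction D φ →
      eLpNorm φ 6 (volume.restrict D) ≤ C * eLpNorm (fderiv ℝ φ) 2 (volume.restrict D) := by
  obtain ⟨p, hp⟩ : ∃ p : NNReal, (p : ℝ) = 3 / 2 := ⟨3 / 2, by norm_num⟩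
  obtain ⟨q, hq⟩ : ∃ q : NNReal, q = 6 := ⟨6, rfl⟩
  obtain ⟨K, hK⟩ : ∃ K : NNReal, ∀ φ : Euc 2 → ℝ, IsTestFunction D φ →
      eLpNorm φ q volume ≤ K * eLpNorm (fderiv ℝ φ) p volume :=
    ⟨_, fun φ hφ => eLpNorm_le_eLpNorm_fderiv_of_le (volume : Measure (Euc 2))
      (hφ.1.of_le (by simp)) ((subset_tsupport φ).trans hφ.2.2)
      (by rw [← NNReal.coe_le_coe, hp]; norm_num)
      (by rw [finrank_euclideanSpace_fin, ← NNReal.coe_lt_coe, hp]; norm_num)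
      (by rw [finrank_euclideanSpace_fin, NNReal.coe_inv, hp, hq]; norm_num) hbdd⟩
  have hp2 : (p : ℝ≥0∞) ≤ 2 := by
    rw [← ENNReal.coe_ofNat, ENNReal.coe_le_coe, ← NNReal.coe_le_coe, hp]
    norm_num
  have hvol : volume D ≠ ⊤ := hbdd.measure_lt_top.ne
  set m := ((volume D) ^ (1 / 6 : ℝ)).toNNReal
  have hm : (m : ℝ≥0∞) = (volume D) ^ (1 / 6 : ℝ) :=
    ENNReal.coe_toNNReal (ENNReal.rpow_ne_top_of_nonneg (by norm_num) hvol)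
  refine ⟨K * m, fun φ hφ => ?_⟩
  have hdc : Continuous (fderiv ℝ φ) := hφ.1.continuous_fderiv (by simp)
  have hsupp : Function.support (fderiv ℝ φ) ⊆ D := (support_fderiv_subset ℝ).trans hφ.2.2
  have h3 := eLpNorm_le_eLpNorm_mul_rpow_measure_univ (μ := volume.restrict D) hp2
    (hdc.aestronglyMeasurable (μ := volume.restrict D))
  have h4 : 1 / (p : ℝ≥0∞).toReal - 1 / (2 : ℝ≥0∞).toReal = 1 / 6 := by
    rw [ENNReal.coe_toReal, hp]
    norm_num
  rw [h4, Measure.restrict_apply_univ, ← hm] at h3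
  have h5 : (6 : ℝ≥0∞) = q := by rw [hq, ENNReal.coe_ofNat]
  calc eLpNorm φ 6 (volume.restrict D) ≤ eLpNorm φ q volume := by
        rw [h5]
        exact eLpNorm_mono_measure _ Measure.restrict_le_self
    _ ≤ K * eLpNorm (fderiv ℝ φ) p volume := hK φ hφ
    _ = K * eLpNorm (fderiv ℝ φ) p (volume.restrict D) := by
        rw [← eLpNorm_norm (fderiv ℝ φ), ← eLpNorm_norm (fderiv ℝ φ),
          eLpNorm_restrict_eq_of_support_subset fun x hx => hsupp fun h => hx (by simp [h])]
    _ ≤ K * (eLpNorm (fderiv ℝ φ) 2 (volume.restrict D) * m) := by gcongr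
    _ = _ := by
        push_cast
        ring

/-- The embedding `H²₀(D) → L⁶(D)` of a bounded planar domain, with the norm `‖Δw‖₂` on the left. -/
theorem exists_eLpNorm_six_le_weakLaplacian {D : Set (Euc 2)} (hbdd : Bornology.IsBounded D) :
    ∃ C : NNReal, ∀ w : Euc 2 → ℝ, MemH20 D w →
      eLpNorm w 6 (volume.restrict D) ≤ C * eLpNorm (weakLaplacian D w) 2 (volume.restrict D) := by
  set μ := (volume : Measure (Euc 2)).restrict D
  have hvol : volume D ≠ ⊤ := hbdd.measure_lt_top.ne
  set m' := ((volume D) ^ (1 / 3 : ℝ)).toNNReal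
  have hm' : (m' : ℝ≥0∞) = (volume D) ^ (1 / 3 : ℝ) :=
    ENNReal.coe_toNNReal (ENNReal.rpow_ne_top_of_nonneg (by norm_num) hvol)
  obtain ⟨K, hK⟩ := exists_eLpNorm_six_le_fderiv hbdd
  have key : ∀ φ : Euc 2 → ℝ, IsTestFunction D φ → eLpNorm φ 6 μ ≤ (K ^ 2 * 2 * m' : NNReal) *
      eLpNorm (fun x => ∑ i, partialDeriv i (partialDeriv i φ) x) 2 μ := by
    intro φ hφ
    set y := eLpNorm (fun x => ∑ i, partialDeriv i (partialDeriv i φ) x) 2 μ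
    have hφm : AEStronglyMeasurable φ μ := hφ.1.continuous.aestronglyMeasurable
    have hsob : eLpNorm φ 6 μ ≤ K * eLpNorm (fderiv ℝ φ) 2 μ := hK φ hφ
    have htwo : eLpNorm φ 2 μ ≤ eLpNorm φ 6 μ * m' := by
      have h3 := eLpNorm_le_eLpNorm_mul_rpow_measure_univ (μ := μ) (f := φ) (p := 2) (q := 6)
        (by norm_num) hφm
      have h4 : 1 / (2 : ℝ≥0∞).toReal - 1 / (6 : ℝ≥0∞).toReal = 1 / 3 := by norm_num
      rwa [h4, Measure.restrict_apply_univ, ← hm'] at h3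
    have hgrad : eLpNorm (fderiv ℝ φ) 2 μ ^ 2 ≤ 2 * (eLpNorm φ 2 μ * y) := by
      rw [eLpNorm_two_sq]
      refine (lintegral_fderiv_sq_le hφ.1 D).trans ?_
      push_cast
      gcongr
      exact hφ.sum_eLpNorm_partialDeriv_sq_le
    -- Both sides carry a factor `‖φ‖₆`, finite for a test function, and cancelling it leaves a
    -- bound linear in `‖Δφ‖₂`.
    have hsq : eLpNorm φ 6 μ * eLpNorm φ 6 μ ≤
        (K ^ 2 * 2 * m' : NNReal) * y * eLpNorm φ 6 μ := by
      calc eLpNorm φ 6 μ * eLpNorm φ 6 μ = eLpNorm φ 6 μ ^ 2 := (sq _).symm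
        _ ≤ (K * eLpNorm (fderiv ℝ φ) 2 μ) ^ 2 := by gcongr
        _ = K ^ 2 * eLpNorm (fderiv ℝ φ) 2 μ ^ 2 := by rw [mul_pow]
        _ ≤ K ^ 2 * (2 * (eLpNorm φ 6 μ * m' * y)) := by
            gcongr
            exact hgrad.trans (by gcongr)
        _ = _ := by
            push_cast
            ring
    by_cases h0 : eLpNorm φ 6 μ = 0
    · simp [h0]
    · have htop : eLpNorm φ 6 μ ≠ ⊤ :=
        ((hφ.1.continuous.memLp_of_hasCompactSupport hφ.2.1).restrict D).2.ne
      exact (ENNReal.mul_le_mul_iff_left h0 htop).1 hsq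
  refine ⟨K ^ 2 * 2 * m', fun w ⟨hw, φ, hφ, hφw, _, hφ2⟩ => ?_⟩
  have hsm : ∀ ψ : Euc 2 → ℝ, ContDiff ℝ ∞ ψ → AEStronglyMeasurable ψ μ :=
    fun ψ hψ => hψ.continuous.aestronglyMeasurable
  have hwm : ∀ i, AEStronglyMeasurable (weakPartial D i (weakPartial D i w)) μ :=
    fun i => ((hw.2 i).memLp_weakPartial i).1
  have hφm : ∀ i k, AEStronglyMeasurable (partialDeriv i (partialDeriv i (φ k))) μ :=
    fun i k => hsm _ (((hφ k).1.partialDeriv i).partialDeriv i)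
  have hlap := (TendstoL2.sum (fun i => hφ2 i i) hφm hwm).tendsto_eLpNorm
    (fun k => Finset.aestronglyMeasurable_fun_sum _ fun i _ => hφm i k)
    (Finset.aestronglyMeasurable_fun_sum _ fun i _ => hwm i)
  exact hφw.eLpNorm_le (fun k => hsm _ (hφ k).1) hw.1.1.1 (fun k => key _ (hφ k))
    (ENNReal.Tendsto.const_mul hlap (Or.inr ENNReal.coe_ne_top))

/-! ### Bounds for the logarithmic and power terms -/

theorem integral_abs_pow_le {α : Type*} [MeasurableSpace α] {μ : Measure α} {f : α → ℝ}
    (hf : AEStronglyMeasurable f μ) {k : ℕ} (hk : k ≠ 0) {C : NNReal} {x : ℝ} (hx : 0 ≤ x)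
    (h : eLpNorm f k μ ≤ C * ENNReal.ofReal x) :
    Integrable (fun a => |f a| ^ k) μ ∧ ∫ a, |f a| ^ k ∂μ ≤ (C * x) ^ k := by
  have hm : AEStronglyMeasurable (fun a => |f a| ^ k) μ := hf.norm.pow k
  have h1 : ∫⁻ a, ENNReal.ofReal (|f a| ^ k) ∂μ ≤ ENNReal.ofReal ((C * x) ^ k) := by
    calc _ = ∫⁻ a, ‖f a‖ₑ ^ k ∂μ := by
          refine lintegral_congr fun a => ?_
          rw [ENNReal.ofReal_pow (abs_nonneg _), Real.enorm_eq_ofReal_abs]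
      _ = eLpNorm f k μ ^ k := (eLpNorm_natCast_pow f μ hk).symm
      _ ≤ (C * ENNReal.ofReal x) ^ k := by gcongr
      _ = _ := by
          rw [ENNReal.ofReal_pow (by positivity), ENNReal.ofReal_mul C.coe_nonneg, ENNReal.ofReal_coe_nnreal]
  have h0 : 0 ≤ᵐ[μ] fun a => |f a| ^ k := Eventually.of_forall fun a => by positivity
  refine ⟨⟨hm, ?_⟩, ?_⟩
  · rw [hasFiniteIntegral_iff_ofReal h0]
    exact h1.trans_lt ENNReal.ofReal_lt_top
  · rw [integral_eq_lintegral_of_nonneg_ae h0 hm]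
    exact ENNReal.toReal_le_of_le_ofReal (by positivity) h1

/-- This is `log s ≤ s^ε / ε` with `ε = 5 - p`, chosen to reach the exponent 6 exactly. -/
theorem rpow_mul_log_le {p s : ℝ} (hp : p < 5) (hs : 0 ≤ s) :
    s ^ (p + 1) * Real.log s ≤ s ^ 6 / (5 - p) := by
  rcases hs.eq_or_lt with rfl | hs
  · simp
  calc s ^ (p + 1) * Real.log s ≤ s ^ (p + 1) * (s ^ (5 - p) / (5 - p)) := by
        gcongr
        exact Real.log_le_rpow_div hs.le (by linarith)
    _ = _ := by
        rw [← mul_div_assoc, ← Real.rpow_add hs, ← Real.rpow_natCast]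
        congr 2
        push_cast
        ring

/-- The same logarithm bound at `1/s` with `ε = p - 1`. It controls the positive contribution to `J`
from the region `|u| < 1`. -/
theorem neg_rpow_mul_log_le {p s : ℝ} (hp : 1 < p) (hs : 0 ≤ s) :
    -(s ^ (p + 1) * Real.log s) ≤ s ^ 2 / (p - 1) := by
  rcases hs.eq_or_lt with rfl | hs
  · simp
  calc -(s ^ (p + 1) * Real.log s) = s ^ (p + 1) * Real.log s⁻¹ := by
        rw [Real.log_inv]
        ring
    _ ≤ s ^ (p + 1) * (s⁻¹ ^ (p - 1) / (p - 1)) := by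
        gcongr
        exact Real.log_le_rpow_div (by positivity) (by linarith)
    _ = _ := by
        rw [← mul_div_assoc, Real.inv_rpow hs.le, ← Real.rpow_neg hs.le, ← Real.rpow_add hs,
          ← Real.rpow_natCast]
        congr 2
        push_cast
        ring

theorem rpow_le_sq_add_pow_six {p s : ℝ} (hp : 1 < p) (hp' : p < 5) (hs : 0 ≤ s) :
    s ^ (p + 1) ≤ s ^ 2 + s ^ 6 := by
  rcases hs.eq_or_lt with rfl | hs
  · simp [Real.zero_rpow (by linarith : p + 1 ≠ 0)]
  rcases le_total s 1 with h | h
  · have := Real.rpow_le_rpow_of_exponent_ge hs h (by push_cast; linarith : ((2 : ℕ) : ℝ) ≤ p + 1)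
    rw [Real.rpow_natCast] at this
    linarith [pow_nonneg hs.le 6]
  · have := Real.rpow_le_rpow_of_exponent_le h (by push_cast; linarith : p + 1 ≤ ((6 : ℕ) : ℝ))
    rw [Real.rpow_natCast] at this
    linarith [pow_nonneg hs.le 2]

theorem integral_log_pow_bounds {α : Type*} [MeasurableSpace α] {μ : Measure α} {f : α → ℝ} {p : ℝ}
    (hp : 1 < p) (hp' : p < 5) (hf : AEStronglyMeasurable f μ)
    (h2 : Integrable (fun a => |f a| ^ 2) μ) (h6 : Integrable (fun a => |f a| ^ 6) μ) :
    ∫ a, |f a| ^ (p + 1) * Real.log |f a| ∂μ ≤ (∫ a, |f a| ^ 6 ∂μ) / (5 - p) ∧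
    -∫ a, |f a| ^ (p + 1) * Real.log |f a| ∂μ ≤ (∫ a, |f a| ^ 2 ∂μ) / (p - 1) ∧
    0 ≤ ∫ a, |f a| ^ (p + 1) ∂μ ∧
    ∫ a, |f a| ^ (p + 1) ∂μ ≤ ∫ a, |f a| ^ 2 ∂μ + ∫ a, |f a| ^ 6 ∂μ := by
  have hm : AEMeasurable (fun a => |f a|) μ := hf.norm.aemeasurable
  have hlog : Integrable (fun a => |f a| ^ (p + 1) * Real.log |f a|) μ := by
    refine ((h6.div_const (5 - p)).add (h2.div_const (p - 1))).mono'
      ((hm.pow_const _).mul (Real.measurable_log.comp_aemeasurable hm)).aestronglyMeasurable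
      (Eventually.of_forall fun a => ?_)
    have h1 := rpow_mul_log_le hp' (abs_nonneg (f a))
    have h3 := neg_rpow_mul_log_le hp (abs_nonneg (f a))
    have h4 : 0 ≤ |f a| ^ 6 / (5 - p) := div_nonneg (by positivity) (by linarith)
    have h5 : 0 ≤ |f a| ^ 2 / (p - 1) := div_nonneg (by positivity) (by linarith)
    rw [Real.norm_eq_abs, abs_le, Pi.add_apply]
    constructor <;> linarith
  have hpow : Integrable (fun a => |f a| ^ (p + 1)) μ := by
    refine (h2.add h6).mono' (hm.pow_const _).aestronglyMeasurable
      (Eventually.of_forall fun a => ?_)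
    rw [Real.norm_eq_abs, abs_of_nonneg (by positivity)]
    exact rpow_le_sq_add_pow_six hp hp' (abs_nonneg _)
  refine ⟨?_, ?_, integral_nonneg fun a => by positivity, ?_⟩
  · rw [← integral_div]
    exact integral_mono hlog (h6.div_const _) fun a => rpow_mul_log_le hp' (abs_nonneg _)
  · rw [← integral_div, ← integral_neg]
    exact integral_mono hlog.neg (h2.div_const _) fun a => neg_rpow_mul_log_le hp (abs_nonneg _)
  · rw [← integral_add h2 h6]
    exact integral_mono hpow (h2.add h6) fun a => rpow_le_sq_add_pow_six hp hp' (abs_nonneg _)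

/-! ### The potential well near the origin -/

namespace AcousticChamber

variable (A : AcousticChamber)

theorem isBounded_D : Bornology.IsBounded A.D := by
  have h : A.e '' A.D ⊆ closure A.Ω :=
    (Set.subset_union_right.trans subset_closure).trans
      (A.frontier_eq.symm.le.trans frontier_subset_closure)
  exact ((A.e.isometry.antilipschitz).isBounded_preimage (A.isBounded_Ω.closure.subset h)).subset
    (Set.subset_preimage_image _ _)

theorem normXSq_nonneg (z : A.Pair) : 0 ≤ A.normXSq z :=
  add_nonneg (integral_nonneg fun _ => Finset.sum_nonneg fun _ _ => sq_nonneg _)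
    (integral_nonneg fun _ => sq_nonneg _)

theorem eLpNorm_weakPartial_le {z : A.Pair} (hz : z ∈ A.X) (i : Fin 3) :
    eLpNorm (weakPartial A.Ω i z.1) 2 (volume.restrict A.Ω) ≤ ENNReal.ofReal (A.normX z) := by
  rw [eLpNorm_two_eq_sqrt (hz.1.1.memLp_weakPartial i)]
  refine ENNReal.ofReal_le_ofReal (Real.sqrt_le_sqrt ?_)
  have hint : ∀ j, Integrable (fun x => weakPartial A.Ω j z.1 x ^ 2) (volume.restrict A.Ω) :=
    fun j => (hz.1.1.memLp_weakPartial j).integrable_sq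
  refine le_trans ?_ (le_add_of_nonneg_right (integral_nonneg fun _ => sq_nonneg _))
  rw [integral_finsetSum _ fun j _ => hint j]
  exact Finset.single_le_sum (f := fun j => ∫ x in A.Ω, weakPartial A.Ω j z.1 x ^ 2)
    (fun j _ => integral_nonneg fun _ => sq_nonneg _) (Finset.mem_univ i)

theorem eLpNorm_weakLaplacian_le {z : A.Pair} (hz : z ∈ A.X) :
    eLpNorm (weakLaplacian A.D z.2) 2 (volume.restrict A.D) ≤ ENNReal.ofReal (A.normX z) := by
  have hL : MemLp (weakLaplacian A.D z.2) 2 (volume.restrict A.D) :=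
    memLp_finsetSum _ fun i _ => (hz.2.1.2 i).memLp_weakPartial i
  rw [eLpNorm_two_eq_sqrt hL]
  exact ENNReal.ofReal_le_ofReal (Real.sqrt_le_sqrt (le_add_of_nonneg_left
    (integral_nonneg fun _ => Finset.sum_nonneg fun _ _ => sq_nonneg _)))

theorem exists_eLpNorm_six_le : ∃ C : NNReal, ∀ z ∈ A.X,
    eLpNorm z.1 6 (volume.restrict A.Ω) ≤ C * ENNReal.ofReal (A.normX z) ∧
    eLpNorm z.2 6 (volume.restrict A.D) ≤ C * ENNReal.ofReal (A.normX z) := by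
  obtain ⟨V, hV, hΓ⟩ := A.relOpen_Γ₀
  obtain ⟨C₁, hC₁⟩ := _root_.exists_eLpNorm_six_le A.isOpen_Ω A.isConnected_Ω.isPreconnected
    A.isBounded_Ω A.smooth_Ω hV (hΓ ▸ A.isConnected_Γ₀.nonempty)
  obtain ⟨C₂, hC₂⟩ := exists_eLpNorm_six_le_weakLaplacian A.isBounded_D
  refine ⟨C₁ * 3 + C₂, fun z hz => ⟨?_, ?_⟩⟩
  · calc _ ≤ C₁ * ∑ i, eLpNorm (weakPartial A.Ω i z.1) 2 (volume.restrict A.Ω) :=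
          hC₁ z.1 (hΓ ▸ hz.1)
      _ ≤ C₁ * ∑ _i : Fin 3, ENNReal.ofReal (A.normX z) := by
          gcongr with i
          exact A.eLpNorm_weakPartial_le hz i
      _ = (C₁ * 3 : NNReal) * ENNReal.ofReal (A.normX z) := by
          simp [mul_assoc]
      _ ≤ _ := by
          gcongr
          exact le_self_add
  · calc _ ≤ C₂ * eLpNorm (weakLaplacian A.D z.2) 2 (volume.restrict A.D) := hC₂ z.2 hz.2
      _ ≤ _ := by
          gcongr
          · exact le_add_self
          · exact A.eLpNorm_weakLaplacian_le hz

theorem eLpNorm_two_le_of_isBounded {n : ℕ} {U : Set (Euc n)} (hU : Bornology.IsBounded U) :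
    ∃ m : NNReal, ∀ f : Euc n → ℝ, AEStronglyMeasurable f (volume.restrict U) →
      eLpNorm f 2 (volume.restrict U) ≤ m * eLpNorm f 6 (volume.restrict U) := by
  refine ⟨((volume U) ^ (1 / 3 : ℝ)).toNNReal, fun f hf => ?_⟩
  have h3 := eLpNorm_le_eLpNorm_mul_rpow_measure_univ (p := 2) (q := 6) (by norm_num) hf
  have h4 : 1 / (2 : ℝ≥0∞).toReal - 1 / (6 : ℝ≥0∞).toReal = 1 / 3 := by norm_num
  rwa [h4, Measure.restrict_apply_univ, mul_comm, ← ENNReal.coe_toNNReal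
    (ENNReal.rpow_ne_top_of_nonneg (by norm_num) hU.measure_lt_top.ne)] at h3

/-- The upper bound on the logarithmic term is cubic in `N`, hence negligible against `N` near zero;
this drives the sign of `I`. The reverse bound is only linear, which suffices for smallness of `J`.
Definiteness of the norm on `X` also comes from the embeddings. -/
theorem exists_bounds {p : ℝ} (hp : 1 < p) (hp' : p < 5) : ∃ K : ℝ, 1 ≤ K ∧ ∀ z ∈ A.X,
    A.logTerm p z ≤ K * A.normXSq z ^ 3 ∧ -A.logTerm p z ≤ K * A.normXSq z ∧
    0 ≤ A.powTerm p z ∧ A.powTerm p z ≤ K * (A.normXSq z + A.normXSq z ^ 3) ∧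
    (A.normXSq z = 0 → z = 0) := by
  obtain ⟨C, hC⟩ := A.exists_eLpNorm_six_le
  obtain ⟨m₁, hm₁⟩ := eLpNorm_two_le_of_isBounded A.isBounded_Ω
  obtain ⟨m₂, hm₂⟩ := eLpNorm_two_le_of_isBounded A.isBounded_D
  set a : ℝ := 2 * (C : ℝ) ^ 6 with ha
  set b : ℝ := (m₁ * C : ℝ) ^ 2 + (m₂ * C : ℝ) ^ 2 with hb
  have ha0 : 0 ≤ a := by positivity
  have hb0 : 0 ≤ b := by positivity
  have hp1 : 0 < p - 1 := by linarith
  have hp5 : 0 < 5 - p := by linarith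
  have hK1 : 0 ≤ a / (5 - p) := div_nonneg ha0 hp5.le
  have hK2 : 0 ≤ b / (p - 1) := div_nonneg hb0 hp1.le
  refine ⟨1 + a / (5 - p) + b / (p - 1) + a + b, by linarith, fun z hz => ?_⟩
  set N := A.normXSq z with hN
  have hN0 : 0 ≤ N := A.normXSq_nonneg z
  have hx0 : 0 ≤ A.normX z := Real.sqrt_nonneg _
  have hx2 : A.normX z ^ 2 = N := Real.sq_sqrt hN0
  have hx6 : A.normX z ^ 6 = N ^ 3 := by rw [← hx2]; ring
  have hf1 := Lp.aestronglyMeasurable z.1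
  have hf2 := Lp.aestronglyMeasurable z.2
  obtain ⟨i16, b16⟩ := integral_abs_pow_le hf1 (k := 6) (by norm_num) hx0 (by simpa using (hC z hz).1)
  obtain ⟨i26, b26⟩ := integral_abs_pow_le hf2 (k := 6) (by norm_num) hx0 (by simpa using (hC z hz).2)
  obtain ⟨i12, b12⟩ := integral_abs_pow_le hf1 (k := 2) (C := m₁ * C) (by norm_num) hx0 (by
    push_cast
    rw [mul_assoc]
    exact (hm₁ _ hf1).trans (by gcongr; exact (hC z hz).1))
  obtain ⟨i22, b22⟩ := integral_abs_pow_le hf2 (k := 2) (C := m₂ * C) (by norm_num) hx0 (by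
    push_cast
    rw [mul_assoc]
    exact (hm₂ _ hf2).trans (by gcongr; exact (hC z hz).2))
  obtain ⟨l1, l1', p1, p1'⟩ := integral_log_pow_bounds hp hp' hf1 i12 i16
  obtain ⟨l2, l2', p2, p2'⟩ := integral_log_pow_bounds hp hp' hf2 i22 i26
  push_cast at b12 b22
  rw [mul_pow, hx6] at b16 b26
  rw [mul_pow, hx2] at b12 b22
  have h6 : (∫ x in A.Ω, |z.1 x| ^ 6) + ∫ y in A.D, |z.2 y| ^ 6 ≤ a * N ^ 3 := by
    rw [ha]; linarith
  have h2 : (∫ x in A.Ω, |z.1 x| ^ 2) + ∫ y in A.D, |z.2 y| ^ 2 ≤ b * N := by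
    rw [hb, add_mul]; linarith
  have hN3 : 0 ≤ N ^ 3 := by positivity
  refine ⟨?_, ?_, add_nonneg p1 p2, ?_, fun h0 => ?_⟩
  · calc A.logTerm p z ≤ ((∫ x in A.Ω, |z.1 x| ^ 6) + ∫ y in A.D, |z.2 y| ^ 6) / (5 - p) := by
          rw [add_div]
          exact add_le_add l1 l2
      _ ≤ a * N ^ 3 / (5 - p) := by gcongr
      _ = a / (5 - p) * N ^ 3 := by ring
      _ ≤ _ := by gcongr; linarith
  · calc -A.logTerm p z ≤ ((∫ x in A.Ω, |z.1 x| ^ 2) + ∫ y in A.D, |z.2 y| ^ 2) / (p - 1) := by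
          rw [add_div, logTerm, neg_add]
          exact add_le_add l1' l2'
      _ ≤ b * N / (p - 1) := by gcongr
      _ = b / (p - 1) * N := by ring
      _ ≤ _ := by gcongr; linarith
  · calc A.powTerm p z ≤ b * N + a * N ^ 3 := by
          rw [powTerm]
          linarith
      _ ≤ (1 + a / (5 - p) + b / (p - 1) + a + b) * N +
          (1 + a / (5 - p) + b / (p - 1) + a + b) * N ^ 3 := by
          gcongr <;> linarith
      _ = _ := by ring
  · have hx : A.normX z = 0 := by rw [normX, ← hN, h0, Real.sqrt_zero]
    have h := hC z hz
    rw [hx, ENNReal.ofReal_zero, mul_zero, nonpos_iff_eq_zero, nonpos_iff_eq_zero,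
      eLpNorm_eq_zero_iff hf1 (by norm_num), eLpNorm_eq_zero_iff hf2 (by norm_num)] at h
    exact Prod.ext ((Lp.eq_zero_iff_ae_eq_zero).2 h.1) ((Lp.eq_zero_iff_ae_eq_zero).2 h.2)

/-- The bound `c / K` on the depth uses only `N ≥ 1 / K` on the Nehari manifold. In the extended
reals it holds without knowing that this manifold is nonempty. -/
theorem exists_ballX_subset {p : ℝ} (hp : 1 < p) (hp' : p < 5) :
    ∃ r : ℝ, 0 < r ∧ A.ballX r ⊆ A.W₁ p := by
  obtain ⟨K, hK1, hK⟩ := A.exists_bounds hp hp'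
  have hK0 : 0 < K := by linarith
  have hI : ∀ z ∈ A.X, z ≠ 0 → A.normXSq z < 1 / K → 0 < A.I p z := by
    intro z hz hz0 hN
    obtain ⟨h1, -, -, -, h5⟩ := hK z hz
    have hNpos : 0 < A.normXSq z := lt_of_le_of_ne (A.normXSq_nonneg z) fun h => hz0 (h5 h.symm)
    have hKN : K * A.normXSq z < 1 := by
      rw [lt_div_iff₀ hK0] at hN
      linarith
    have hN1 : A.normXSq z < 1 := by nlinarith
    have : K * A.normXSq z ^ 3 < A.normXSq z := by
      calc K * A.normXSq z ^ 3 = (K * A.normXSq z) * A.normXSq z * A.normXSq z := by ring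
        _ < 1 * A.normXSq z := by
          gcongr
          nlinarith
        _ = _ := one_mul _
    rw [I]
    linarith
  -- This is `1/2 - 1/(p+1)`, the coefficient of `N` left in `J` when `I = 0`.
  set c : ℝ := (p - 1) / (2 * (p + 1)) with hc
  have hc0 : 0 < c := div_pos (by linarith) (by linarith)
  have hc1 : c < 1 := by
    rw [hc, div_lt_one (by linarith)]
    linarith
  have hd : ((c / K : ℝ) : EReal) ≤ A.depth p := by
    refine le_iInf₂ fun z ⟨hzX, hz0, hzI⟩ => EReal.coe_le_coe_iff.2 ?_
    have hN : 1 / K ≤ A.normXSq z := by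
      by_contra! h
      exact (hI z hzX hz0 h).ne' hzI
    have hL : A.logTerm p z = A.normXSq z := by
      rw [I] at hzI
      linarith
    have hP : 0 ≤ 1 / (p + 1) ^ 2 * A.powTerm p z :=
      mul_nonneg (by positivity) (hK z hzX).2.2.1
    have hcN : 1 / 2 * A.normXSq z - 1 / (p + 1) * A.normXSq z = c * A.normXSq z := by
      have : p + 1 ≠ 0 := by linarith
      rw [hc]
      field_simp
      ring
    calc c / K = c * (1 / K) := by ring
      _ ≤ c * A.normXSq z := by gcongr
      _ ≤ _ := by
        rw [J, hL]
        linarith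
  have hs : 0 < c / (4 * K ^ 2) := by positivity
  -- The radius makes `4 K N < c / K`, and it also forces `N < 1 / K` because `c < 1 ≤ K`.
  refine ⟨√(c / (4 * K ^ 2)), Real.sqrt_pos.2 hs, fun z ⟨hzX, hz⟩ => ?_⟩
  have hN : A.normXSq z < c / (4 * K ^ 2) := (Real.sqrt_lt_sqrt_iff (A.normXSq_nonneg z)).1 hz
  have hN0 := A.normXSq_nonneg z
  by_cases hz0 : z = 0
  · exact Or.inr hz0
  have hNK : A.normXSq z < 1 / K := by
    refine hN.trans ?_
    rw [div_lt_div_iff₀ (by positivity) hK0]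
    nlinarith
  refine Or.inl ⟨⟨hzX, lt_of_lt_of_le (EReal.coe_lt_coe_iff.2 ?_) hd⟩, hI z hzX hz0 hNK⟩
  obtain ⟨-, h2, h3, h4, -⟩ := hK z hzX
  have hN1 : A.normXSq z ≤ 1 := hNK.le.trans ((div_le_one hK0).2 hK1)
  have hN3 : A.normXSq z ^ 3 ≤ A.normXSq z := by
    calc A.normXSq z ^ 3 ≤ A.normXSq z ^ 1 := pow_le_pow_of_le_one hN0 hN1 (by norm_num)
      _ = _ := pow_one _
  have hp1 : 1 / (p + 1) ≤ 1 := by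
    rw [div_le_one (by linarith)]
    linarith
  have hp2 : 1 / (p + 1) ^ 2 ≤ 1 := by
    rw [div_le_one (by positivity)]
    nlinarith
  have hlog : 1 / (p + 1) * -A.logTerm p z ≤ K * A.normXSq z :=
    calc _ ≤ 1 / (p + 1) * (K * A.normXSq z) := by gcongr
      _ ≤ _ := mul_le_of_le_one_left (by positivity) hp1
  have hpow : 1 / (p + 1) ^ 2 * A.powTerm p z ≤ K * (A.normXSq z + A.normXSq z) :=
    (mul_le_of_le_one_left h3 hp2).trans (h4.trans (by gcongr))
  -- The three terms of `J` contribute at most `N / 2`, `K N` and `2 K N`, and `K ≥ 1`.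
  calc A.J p z ≤ 4 * K * A.normXSq z := by
        rw [J]
        nlinarith
    _ < 4 * K * (c / (4 * K ^ 2)) := by gcongr
    _ = c / K := by
        field_simp

end AcousticChamber

/-! ### Nonzero elements in every ball -/

/-- The fundamental lemma of the calculus of variations. As `weakPartial` is an arbitrary choice,
this uniqueness is what identifies it with the classical derivative of a test function. -/
theorem IsWeakPartial.ae_eq {n : ℕ} {U : Set (Euc n)} (hU : IsOpen U) {i : Fin n}
    {u g g' : Euc n → ℝ} (h : IsWeakPartial U i u g) (h' : IsWeakPartial U i u g') :
    g =ᵐ[volume.restrict U] g' := by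
  have hloc : ∀ f : Euc n → ℝ, MemLp f 2 (volume.restrict U) → LocallyIntegrable f (volume.restrict U) :=
    fun f hf => hf.locallyIntegrable (by norm_num)
  have hzero : ∀ᵐ x, x ∈ U → (g - g') x = 0 := by
    refine hU.ae_eq_zero_of_integral_contDiff_smul_eq_zero
      (locallyIntegrableOn_of_locallyIntegrable_restrict (hloc _ (h.2.1.sub h'.2.1)))
      fun φ hφ hφc hφU => ?_
    have hmem : MemLp φ 2 (volume.restrict U) :=
      (hφ.continuous.memLp_of_hasCompactSupport hφc).restrict U
    rw [← setIntegral_eq_integral_of_forall_compl_eq_zero (s := U) fun x hx => by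
      rw [image_eq_zero_of_notMem_tsupport fun h => hx (hφU h), zero_smul]]
    have h1 := h.2.2 φ ⟨hφ, hφc, hφU⟩
    have h2 := h'.2.2 φ ⟨hφ, hφc, hφU⟩
    have h3 : ∫ x in U, φ x • (g - g') x = (∫ x in U, g x * φ x) - ∫ x in U, g' x * φ x := by
      have i1 : Integrable (fun x => g x * φ x) (volume.restrict U) := h.2.1.integrable_mul hmem
      have i2 : Integrable (fun x => g' x * φ x) (volume.restrict U) := h'.2.1.integrable_mul hmem
      rw [← integral_sub i1 i2]
      refine integral_congr_ae (Eventually.of_forall fun x => ?_)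
      simp only [smul_eq_mul, Pi.sub_apply]
      ring
    rw [h3]
    linarith
  rw [EventuallyEq, ae_restrict_iff' hU.measurableSet]
  filter_upwards [hzero] with x hx hxU using sub_eq_zero.1 (hx hxU)

namespace IsTestFunction

variable {n : ℕ} {U : Set (Euc n)} {φ u : Euc n → ℝ}

theorem memLp (hφ : IsTestFunction U φ) : MemLp φ 2 (volume.restrict U) :=
  (hφ.1.continuous.memLp_of_hasCompactSupport hφ.2.1).restrict U

theorem isWeakPartial (hφ : IsTestFunction U φ) (hu : u =ᵐ[volume.restrict U] φ) (i : Fin n) :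
    IsWeakPartial U i u (_root_.partialDeriv i φ) := by
  refine ⟨hφ.memLp.ae_eq hu.symm, (hφ.partialDeriv i).memLp, fun ψ hψ => ?_⟩
  have hset : ∀ f g : Euc n → ℝ, IsTestFunction U f → ∫ x in U, f x * g x = ∫ x, f x * g x :=
    fun f g hf => setIntegral_eq_integral_of_forall_compl_eq_zero fun x hx => by
      rw [image_eq_zero_of_notMem_tsupport fun h => hx (hf.2.2 h), zero_mul]
  calc ∫ x in U, u x * _root_.partialDeriv i ψ x = ∫ x in U, φ x * _root_.partialDeriv i ψ x :=
        integral_congr_ae (hu.mono fun x hx => by simp only [hx])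
    _ = - ∫ x in U, _root_.partialDeriv i φ x * ψ x := by
        rw [hset _ _ hφ, hset _ _ (hφ.partialDeriv i), hφ.integral_mul_partialDeriv hψ.1]

theorem memH1 (hφ : IsTestFunction U φ) (hu : u =ᵐ[volume.restrict U] φ) : MemH1 U u :=
  ⟨hφ.memLp.ae_eq hu.symm, fun i => ⟨_, hφ.isWeakPartial hu i⟩⟩

theorem weakPartial_ae_eq (hφ : IsTestFunction U φ) (hU : IsOpen U)
    (hu : u =ᵐ[volume.restrict U] φ) (i : Fin n) :
    weakPartial U i u =ᵐ[volume.restrict U] _root_.partialDeriv i φ :=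
  (isWeakPartial_weakPartial ⟨_, hφ.isWeakPartial hu i⟩).ae_eq hU (hφ.isWeakPartial hu i)

end IsTestFunction

theorem tendstoL2_const_of_ae_eq {α : Type*} [MeasurableSpace α] {μ : Measure α} {f g : α → ℝ}
    (h : g =ᵐ[μ] f) : TendstoL2 μ (fun _ => f) g := by
  have : eLpNorm (fun x => f x - g x) 2 μ = 0 := by
    rw [eLpNorm_congr_ae (g := fun _ => 0) (h.mono fun x hx => by simp [hx])]
    exact eLpNorm_zero
  simp only [TendstoL2, this, tendsto_const_nhds]

theorem IsTestFunction.memH20 {n : ℕ} {U : Set (Euc n)} {φ u : Euc n → ℝ}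
    (hφ : IsTestFunction U φ) (hU : IsOpen U) (hu : u =ᵐ[volume.restrict U] φ) : MemH20 U u :=
  ⟨⟨hφ.memH1 hu, fun i => (hφ.partialDeriv i).memH1 (hφ.weakPartial_ae_eq hU hu i)⟩,
    fun _ => φ, fun _ => hφ, tendstoL2_const_of_ae_eq hu,
    fun i => tendstoL2_const_of_ae_eq (hφ.weakPartial_ae_eq hU hu i),
    fun i j => tendstoL2_const_of_ae_eq
      ((hφ.partialDeriv j).weakPartial_ae_eq hU (hφ.weakPartial_ae_eq hU hu j) i)⟩

theorem IsTestFunction.hasTrace {U S : Set (Euc 3)} {φ u : Euc 3 → ℝ} (hφ : IsTestFunction U φ)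
    (hU : IsOpen U) (hS : MeasurableSet S) (hSU : Disjoint S U)
    (hu : u =ᵐ[volume.restrict U] φ) : HasTrace U S u 0 := by
  refine ⟨hφ.memH1 hu, fun _ => φ, fun _ => hφ.1, tendstoL2_const_of_ae_eq hu,
    fun i => tendstoL2_const_of_ae_eq (hφ.weakPartial_ae_eq hU hu i), tendstoL2_const_of_ae_eq ?_⟩
  refine ae_restrict_of_forall_mem hS fun x hx => ?_
  by_contra h
  exact Set.disjoint_left.1 hSU hx (hφ.2.2 (subset_tsupport φ fun h' => h (by simp [h'])))

theorem IsTestFunction.const_mul {n : ℕ} {U : Set (Euc n)} {φ : Euc n → ℝ}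
    (hφ : IsTestFunction U φ) (ε : ℝ) : IsTestFunction U fun x => ε * φ x :=
  ⟨contDiff_const.mul hφ.1, hφ.2.1.mul_left, (tsupport_mul_subset_right).trans hφ.2.2⟩

theorem exists_isTestFunction {n : ℕ} {U : Set (Euc n)} (hU : IsOpen U) {x : Euc n} (hx : x ∈ U) :
    ∃ φ : Euc n → ℝ, IsTestFunction U φ ∧ φ x ≠ 0 := by
  obtain ⟨r, hr, hball⟩ := Metric.isOpen_iff.1 hU x hx
  let χ : ContDiffBump x := ⟨r / 4, r / 2, by positivity, by linarith⟩
  refine ⟨χ, ⟨χ.contDiff, χ.hasCompactSupport, ?_⟩, ?_⟩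
  · rw [χ.tsupport_eq]
    exact (Metric.closedBall_subset_ball (by change r / 2 < r; linarith)).trans hball
  · rw [χ.one_of_mem_closedBall (Metric.mem_closedBall_self (by positivity))]
    exact one_ne_zero

theorem not_ae_eq_zero_of_continuous {n : ℕ} {U : Set (Euc n)} (hU : IsOpen U) {φ : Euc n → ℝ}
    (hφ : Continuous φ) {x : Euc n} (hx : x ∈ U) (hφx : φ x ≠ 0) :
    ¬ φ =ᵐ[volume.restrict U] 0 := by
  intro h
  have hopen : IsOpen (U ∩ {y | φ y ≠ 0}) := hU.inter (isOpen_ne_fun hφ continuous_const)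
  have hzero : volume (U ∩ {y | φ y ≠ 0}) = 0 := by
    rw [EventuallyEq, ae_restrict_iff' hU.measurableSet] at h
    refine measure_mono_null (fun y hy => ?_) (ae_iff.1 h)
    exact fun hcon => hy.2 (hcon hy.1)
  exact (hopen.measure_pos volume ⟨x, hx, hφx⟩).ne' hzero

namespace AcousticChamber

variable (A : AcousticChamber)

/-- The element is `(ε φ, 0)` with `φ` a bump function in `Ω`. Constant sequences witness its trace
and its membership in the closure, and its squared norm scales as `ε²`. -/
theorem exists_mem_ballX_ne_zero {r : ℝ} (hr : 0 < r) : ∃ z ∈ A.ballX r, z ≠ 0 := by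
  obtain ⟨x, hx⟩ := A.isConnected_Ω.nonempty
  obtain ⟨φ, hφ, hφx⟩ := exists_isTestFunction A.isOpen_Ω hx
  set G := ∫ x in A.Ω, ∑ i, partialDeriv i φ x ^ 2
  obtain ⟨ε, hεpos, hεG⟩ : ∃ ε : ℝ, 0 < ε ∧ ε ^ 2 * G < r ^ 2 := by
    have hc : Tendsto (fun ε : ℝ => ε ^ 2 * G) (𝓝[>] 0) (𝓝 0) := by
      have : Continuous fun ε : ℝ => ε ^ 2 * G := by fun_prop
      simpa using (this.tendsto 0).mono_left nhdsWithin_le_nhds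
    obtain ⟨ε, h, hε⟩ := ((hc.eventually_lt_const (by positivity : (0 : ℝ) < r ^ 2)).and
      self_mem_nhdsWithin).exists
    exact ⟨ε, hε, h⟩
  have hφε := hφ.const_mul ε
  let z : A.Pair := (hφε.memLp.toLp _, 0)
  have hz1 : z.1 =ᵐ[volume.restrict A.Ω] fun x => ε * φ x := hφε.memLp.coeFn_toLp
  have hz2 : z.2 =ᵐ[volume.restrict A.D] 0 := Lp.coeFn_zero _ _ _
  have h0 : IsTestFunction A.D 0 := ⟨contDiff_const, HasCompactSupport.zero, by simp⟩
  obtain ⟨V, hV, hΓ⟩ := A.relOpen_Γ₀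
  have hS : MeasurableSet A.Γ₀ := by
    rw [hΓ]
    exact isClosed_frontier.measurableSet.inter hV.measurableSet
  have hdisj : Disjoint A.Γ₀ A.Ω := by
    rw [hΓ]
    exact (disjoint_frontier_iff_isOpen.2 A.isOpen_Ω).mono_left Set.inter_subset_left
  have hzX : z ∈ A.X := ⟨hφε.hasTrace A.isOpen_Ω hS hdisj hz1, h0.memH20 A.isOpen_D hz2⟩
  have hN : A.normXSq z = ε ^ 2 * G := by
    have h1 : ∫ x in A.Ω, ∑ i, weakPartial A.Ω i z.1 x ^ 2 = ε ^ 2 * G := by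
      rw [← integral_const_mul]
      refine integral_congr_ae ?_
      filter_upwards [ae_all_iff.2 fun i => hφε.weakPartial_ae_eq A.isOpen_Ω hz1 i] with x hx
      rw [Finset.mul_sum]
      refine Finset.sum_congr rfl fun i _ => ?_
      rw [hx i, ← mul_pow]
      congr 1
      rw [partialDeriv, fderiv_const_mul (hφ.1.differentiable (by simp) x)]
      rfl
    have h2 : ∫ y in A.D, weakLaplacian A.D z.2 y ^ 2 = 0 := by
      have hz : ∀ i : Fin 2, (partialDeriv i 0 : Euc 2 → ℝ) = 0 := fun i => by
        ext x
        simp [partialDeriv]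
      rw [← integral_zero (Euc 2) ℝ (μ := volume.restrict A.D)]
      refine integral_congr_ae ?_
      filter_upwards [ae_all_iff.2 fun i => (h0.partialDeriv i).weakPartial_ae_eq A.isOpen_D
        (h0.weakPartial_ae_eq A.isOpen_D hz2 i) i] with y hy
      simp [weakLaplacian, hy, hz]
    rw [normXSq, h1, h2, add_zero]
  refine ⟨z, ⟨hzX, ?_⟩, fun h => ?_⟩
  · rw [normX, hN, Real.sqrt_lt' hr]
    exact hεG
  · refine not_ae_eq_zero_of_continuous A.isOpen_Ω hφε.1.continuous hx
      (mul_ne_zero hεpos.ne' hφx) (hz1.symm.trans ?_)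
    rw [h]
    exact Lp.coeFn_zero _ _ _

end AcousticChamber

theorem proposition2p3 (A : AcousticChamber) (p : ℝ) (hp : 1 < p) (hp' : p < 5) :
    (A.W₁ p).Nontrivial ∧ ∃ r : ℝ, 0 < r ∧ A.ballX r ⊆ A.W₁ p := by
  obtain ⟨r, hr, hsub⟩ := A.exists_ballX_subset hp hp'
  obtain ⟨z, hz, hz0⟩ := A.exists_mem_ballX_ne_zero hr
  exact ⟨⟨z, hsub hz, 0, Or.inr rfl, hz0⟩, r, hr, hsub⟩
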